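/- Let $G$ be a locally compact (Hausdorff) group with left Haar measure $\mu$, and let $S\subset G$ be a closed subsemigroup containing the identity $e$ such that $G=S^{-1}S$. For $g\in G$ let $L_g$ be the unitary $(L_gf)(x)=f(g^{-1}x)$ on $L^2(G)$. Let $H_S\subset L^2(G)$ be the subspace of functions with essential support in $S$, $J_S:H_S\to L^2(G)$ the inclusion and $E_S$ the orthogonal projection onto $H_S$. For $a\in S$ put $T_a=E_SL_aJ_S\in B(H_S)$ (an isometry), and let $C^*_\delta(S)\subset B(H_S)$ be the $C^*$-algebra generated by $\{T_a: a\in S\}$. Let $D_\delta(S)\subset B(H_S)$ be the $C^*$-algebra generated by those finite products $T_w$ of operators $T_a,T_a^*$ ($a\in S$) whose index, i.e. the corresponding product of the elements $a,a^{-1}$ in $G$, equals $e$. Order $S$ by $p\le q\iff qp^{-1}\in S$, and let $D_\delta^{(\infty)}(S)$ be the $C^*$-inductive limit of the directed system with $\mathcal A_p=D_\delta(S)$ for all $p\in S$ and connecting maps $\tau_{qp^{-1}}:\mathcal A_p\to\mathcal A_q$, $\tau_{s}(A)=T_{s}AT_{s}^*$. The maps $\phi_p:\mathcal A_p\to B(L^2(G))$,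 $\phi_p(A)=L_p^*J_SAE_SL_p$, induce a faithful representation $\Phi$ of $D_\delta^{(\infty)}(S)$ on $L^2(G)$, whose range is invariant under conjugation by every $L_g$; let $\tau(g)u=\Phi^{-1}(L_g\Phi(u)L_g^*)$ be the resulting action of $G$. Let the reduced crossed product $D_\delta^{(\infty)}(S)\rtimes_{r,\tau}G$ be the $C^*$-algebra of operators on $L^2(G;L^2(G))$ generated by all products $\widetilde\Phi(u)\widetilde L_g$, $u\in D_\delta^{(\infty)}(S)$, $g\in G$, where $(\widetilde\Phi,\widetilde L)$ is the regular representation induced from $\Phi$: $$(\widetilde\Phi(u)\xi)(h)=\Phi(\tau(h^{-1})u)\,\xi(h),\qquad (\widetilde L_g\xi)(h)=\xi(g^{-1}h).$$ (For discrete $G$ this is the usual reduced crossed product.) **Theorem.** There is an injective $*$-homomorphism $\pi: D_\delta^{(\infty)}(S)\rtimes_{r,\tau}G\to B(L^2(G))$ with $\pi(\widetilde\Phi(u)\widetilde L_g)=\Phi(u)L_g$ for all $u\in D_\delta^{(\infty)}(S)$, $g\in G$, and $C^*_\delta(S)$ is isomorphic to the corner $$E_S\,\pi\big(D_\delta^{(\infty)}(S)\rtimes_{r,\tau}G\big)\,E_S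 ,$$ that is, there is an injective $*$-homomorphism $\Psi:C^*_\delta(S)\to B(L^2(G))$ whose range is exactly $\{E_S\,\pi(A)\,E_S: A\in D_\delta^{(\infty)}(S)\rtimes_{r,\tau}G\}$. -/

import Mathlib

open MeasureTheory Filter Topology UniformSpace
open scoped ENNReal

set_option linter.unusedSectionVars false

noncomputable section
namespace SemigroupCStar

/-! ### The completion of a normed *-algebra with the C*-identity -/

section Completion

variable (A : Type*) [NonUnitalNormedRing A] [StarRing A] [CStarRing A] [NormedSpace ℂ A]
  [IsScalarTower ℂ A A] [SMulCommClass ℂ A A] [StarModule ℂ A]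

/-- The C*-completion of `A`: its metric completion, to which the product and the
involution are extended by continuity. -/
def CStarCompletion : Type _ := Completion A

namespace CStarCompletion

instance : NormedAddCommGroup (CStarCompletion A) :=
  inferInstanceAs (NormedAddCommGroup (Completion A))

instance : NormedSpace ℂ (CStarCompletion A) :=
  inferInstanceAs (NormedSpace ℂ (Completion A))

instance : CompleteSpace (CStarCompletion A) :=
  inferInstanceAs (CompleteSpace (Completion A))

variable {A}

/-- The canonical embedding of `A` into its completion. -/
def of : A →ₗᵢ[ℂ] CStarCompletion A := Completion.toComplₗᵢ

theorem denseRange_of : DenseRange (of : A → CStarCompletion A) := Completion.denseRange_coe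

theorem isUniformInducing_of : IsUniformInducing (of : A → CStarCompletion A) :=
  of.isometry.isUniformInducing

/-- The product of `A`, extended by continuity in one variable after the other. -/
def mulL : CStarCompletion A →L[ℂ] CStarCompletion A →L[ℂ] CStarCompletion A :=
  ((((ContinuousLinearMap.compL ℂ A A (CStarCompletion A)
    of.toContinuousLinearMap).comp (ContinuousLinearMap.mul ℂ A)).flip.extend
      of.toContinuousLinearMap).flip.extend of.toContinuousLinearMap)

instance : Mul (CStarCompletion A) where
  mul x y := mulL x y

instance : Star (CStarCompletion A) where
  star := Completion.map star

theorem mul_def (x y : CStarCompletion A) : x * y = mulL x y := rfl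

theorem of_mul (a b : A) : of (a * b) = of a * of b := by
  rw [mul_def, mulL]
  have h1 := ContinuousLinearMap.extend_eq (((((ContinuousLinearMap.compL ℂ A A (CStarCompletion A)
    of.toContinuousLinearMap).comp (ContinuousLinearMap.mul ℂ A)).flip.extend
      of.toContinuousLinearMap).flip)) (e := of.toContinuousLinearMap) denseRange_of
      isUniformInducing_of a
  have h2 := ContinuousLinearMap.extend_eq ((((ContinuousLinearMap.compL ℂ A A (CStarCompletion A)
    of.toContinuousLinearMap).comp (ContinuousLinearMap.mul ℂ A)).flip))
    (e := of.toContinuousLinearMap) denseRange_of isUniformInducing_of b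
  simp only [LinearIsometry.coe_toContinuousLinearMap] at h1 h2
  rw [h1, ContinuousLinearMap.flip_apply, h2]
  rfl

theorem continuous_mul' : Continuous fun p : CStarCompletion A × CStarCompletion A ↦
    p.1 * p.2 :=
  (mulL (A := A)).continuous₂

theorem of_star (a : A) : of (star a) = star (of a) :=
  (Completion.map_coe (uniformContinuous_of_continuousAt_zero (starAddEquiv (R := A))
    (starAddEquiv (R := A) |> fun _ ↦ continuous_star.continuousAt)) a).symm

theorem continuous_star' : Continuous (star : CStarCompletion A → CStarCompletion A) :=
  Completion.continuous_map

@[elab_as_elim]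
theorem induction_on {p : CStarCompletion A → Prop} (x : CStarCompletion A)
    (hp : IsClosed {x | p x}) (h : ∀ a, p (of a)) : p x :=
  Completion.induction_on x hp h

@[elab_as_elim]
theorem induction_on₂ {p : CStarCompletion A → CStarCompletion A → Prop}
    (x y : CStarCompletion A)
    (hp : IsClosed {x : CStarCompletion A × CStarCompletion A | p x.1 x.2})
    (h : ∀ a b, p (of a) (of b)) : p x y :=
  Completion.induction_on₂ x y hp h

instance : NonUnitalNormedRing (CStarCompletion A) where
  left_distrib x y z := by simp [mul_def]
  right_distrib x y z := by simp [mul_def]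
  zero_mul x := by simp [mul_def]
  mul_zero x := by simp [mul_def]
  mul_assoc x y z := by
    induction x, y using induction_on₂
    · simp only [mul_def]
      exact isClosed_eq (by fun_prop) (by fun_prop)
    · induction z using induction_on
      · simp only [mul_def]
        exact isClosed_eq (by fun_prop) (by fun_prop)
      · rename_i c
        simp only [← of_mul, mul_assoc]
  dist_eq x y := NormedAddCommGroup.dist_eq x y
  norm_mul_le x y := by
    induction x, y using induction_on₂
    · exact isClosed_le continuous_mul'.norm (by fun_prop)
    · rename_i a b
      rw [← of_mul]
      simpa using norm_mul_le a b

instance : StarRing (CStarCompletion A) where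
  star_involutive x := by
    induction x using induction_on
    · exact isClosed_eq (continuous_star'.comp continuous_star') continuous_id
    · rename_i a
      rw [← of_star, ← of_star, star_star]
  star_mul x y := by
    induction x, y using induction_on₂
    · exact isClosed_eq (continuous_star'.comp continuous_mul')
        (continuous_mul'.comp ((continuous_star'.comp continuous_snd).prodMk
          (continuous_star'.comp continuous_fst)))
    · rename_i a b
      simp only [← of_star, ← of_mul, star_mul]
  star_add x y := by
    induction x, y using induction_on₂
    · exact isClosed_eq (continuous_star'.comp continuous_add)
        ((continuous_star'.comp continuous_fst).add (continuous_star'.comp continuous_snd))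
    · rename_i a b
      simp only [← of_star, ← map_add, star_add]

/-- The completion is a C*-algebra. -/
instance : NonUnitalCStarAlgebra (CStarCompletion A) where
  norm_mul_self_le x := by
    induction x using induction_on
    · exact isClosed_le (by fun_prop)
        (continuous_mul'.comp (continuous_star'.prodMk continuous_id)).norm
    · rename_i a
      rw [← of_star, ← of_mul]
      simpa using CStarRing.norm_mul_self_le a
  smul_assoc r x y := by simp [mul_def]
  smul_comm r x y := by simp [mul_def]
  star_smul r x := by
    induction x using induction_on
    · exact isClosed_eq (continuous_star'.comp (continuous_const_smul r))
        (continuous_star'.const_smul (star r))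
    · rename_i a
      rw [← map_smul, ← of_star, ← of_star, ← map_smul, star_smul]

section lift

variable {B : Type*} [NonUnitalCStarAlgebra B] (φ : A →⋆ₙₐ[ℂ] B) (hφ : ∀ a, ‖φ a‖ = ‖a‖)

/-- An isometric *-homomorphism into a C*-algebra, as a linear isometry. -/
def toIsometry : A →ₗᵢ[ℂ] B where
  toFun := φ
  map_add' := map_add φ
  map_smul' := map_smul φ
  norm_map' := hφ

/-- The extension by continuity of an isometric *-homomorphism to the completion. -/
def liftL : CStarCompletion A →L[ℂ] B :=
  (toIsometry φ hφ).toContinuousLinearMap.extend of.toContinuousLinearMap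

theorem liftL_of (a : A) : liftL φ hφ (of a) = φ a :=
  ContinuousLinearMap.extend_eq (toIsometry φ hφ).toContinuousLinearMap
    (e := of.toContinuousLinearMap) denseRange_of isUniformInducing_of a

/-- The extension by continuity of an isometric *-homomorphism to the completion, as a
*-homomorphism. -/
def lift : CStarCompletion A →⋆ₙₐ[ℂ] B where
  toFun := liftL φ hφ
  map_smul' := map_smul (liftL φ hφ)
  map_zero' := map_zero _
  map_add' := map_add _
  map_mul' x y := by
    induction x, y using induction_on₂
    · exact isClosed_eq ((liftL φ hφ).continuous.comp continuous_mul')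
        (((liftL φ hφ).continuous.comp continuous_fst).mul
          ((liftL φ hφ).continuous.comp continuous_snd))
    · simp only [← of_mul, liftL_of, map_mul]
  map_star' x := by
    induction x using induction_on
    · exact isClosed_eq ((liftL φ hφ).continuous.comp continuous_star')
        (liftL φ hφ).continuous.star
    · simp only [← of_star, liftL_of, map_star]

theorem lift_of (a : A) : lift φ hφ (of a) = φ a := liftL_of φ hφ a

theorem continuous_lift : Continuous (lift φ hφ) := (liftL φ hφ).continuous

theorem norm_lift (x : CStarCompletion A) : ‖lift φ hφ x‖ = ‖x‖ := by
  induction x using induction_on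
  · exact isClosed_eq (continuous_lift φ hφ).norm continuous_norm
  · rw [lift_of, hφ, LinearIsometry.norm_map]

end lift

end CStarCompletion
end Completion
/-! ### Inductive limits of C*-algebras along injective homomorphisms -/

section InductiveLimit

variable {ι : Type*} [Preorder ι] [IsDirectedOrder ι] [Nonempty ι] (A : ι → Type*)
  [∀ i, NonUnitalCStarAlgebra (A i)] (f : ∀ i j, i ≤ j → (A i →⋆ₙₐ[ℂ] A j))
  [DirectedSystem A (f · · ·)] [hf : Fact (∀ i j h, Function.Injective (f i j h))]

/-- The algebraic direct limit of a directed system of C*-algebras with injective connecting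
homomorphisms. -/
def AlgLimit : Type _ := DirectLimit A f

namespace AlgLimit

instance : NonUnitalRing (AlgLimit A f) := inferInstanceAs (NonUnitalRing (DirectLimit A f))
instance : StarRing (AlgLimit A f) := inferInstanceAs (StarRing (DirectLimit A f))
instance : Module ℂ (AlgLimit A f) := inferInstanceAs (Module ℂ (DirectLimit A f))
instance : IsScalarTower ℂ (AlgLimit A f) (AlgLimit A f) :=
  inferInstanceAs (IsScalarTower ℂ (DirectLimit A f) (DirectLimit A f))
instance : SMulCommClass ℂ (AlgLimit A f) (AlgLimit A f) :=
  inferInstanceAs (SMulCommClass ℂ (DirectLimit A f) (DirectLimit A f))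
instance : StarModule ℂ (AlgLimit A f) := inferInstanceAs (StarModule ℂ (DirectLimit A f))

/-- The class in the direct limit of an element of the algebra with index `i`. -/
def mk (i : ι) : A i →⋆ₙₐ[ℂ] AlgLimit A f where
  toFun a := (⟦⟨i, a⟩⟧ : DirectLimit A f)
  map_smul' c a := (DirectLimit.smul_def (f := f) i a c).symm
  map_zero' := (DirectLimit.zero_def (f := f) i).symm
  map_add' a b := (DirectLimit.add_def (f := f) i a b).symm
  map_mul' a b := (DirectLimit.mul_def (f := f) i a b).symm
  map_star' a := (DirectLimit.star_def (f := f) i a).symm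

theorem mk_conn {i j : ι} (h : i ≤ j) (a : A i) : mk A f j (f i j h a) = mk A f i a :=
  DirectLimit.mk_apply (f := f) i j a h

variable {A f}

@[elab_as_elim]
theorem induction {p : AlgLimit A f → Prop} (x : AlgLimit A f) (h : ∀ i a, p (mk A f i a)) :
    p x :=
  DirectLimit.induction f h x

@[elab_as_elim]
theorem induction₂ {p : AlgLimit A f → AlgLimit A f → Prop} (x y : AlgLimit A f)
    (h : ∀ i a b, p (mk A f i a) (mk A f i b)) : p x y :=
  DirectLimit.induction₂ f h x y

/-- The norm of the direct limit; it is well defined because the connecting homomorphisms, being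
injective, are isometric. -/
instance : Norm (AlgLimit A f) where
  norm := DirectLimit.lift f (fun _ a ↦ ‖a‖) fun i j h a ↦
    (NonUnitalStarAlgHom.norm_map (f i j h) (hf.out i j h) a).symm

theorem norm_mk (i : ι) (a : A i) : ‖mk A f i a‖ = ‖a‖ := rfl

instance : NormedAddCommGroup (AlgLimit A f) where
  __ := AddGroupNorm.toNormedAddCommGroup (E := AlgLimit A f)
    { toFun := norm
      map_zero' := by
        rw [← map_zero (mk A f (Classical.arbitrary ι)), norm_mk, norm_zero]
      add_le' := fun x y ↦ by
        induction x, y using induction₂ with | h i a b => ?_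
        rw [← map_add, norm_mk]
        exact norm_add_le a b
      neg' := fun x ↦ by
        induction x using induction with | h i a => ?_
        rw [← map_neg, norm_mk, norm_mk, norm_neg]
      eq_zero_of_map_eq_zero' := fun x ↦ by
        induction x using induction with | h i a => ?_
        intro h
        have : a = 0 := norm_eq_zero.1 h
        rw [this, map_zero] }

instance : NonUnitalNormedRing (AlgLimit A f) where
  __ := (inferInstance : NonUnitalRing (AlgLimit A f))
  __ := (inferInstance : NormedAddCommGroup (AlgLimit A f))
  norm_mul_le x y := by
    induction x, y using induction₂ with | h i a b => ?_
    rw [← map_mul, norm_mk]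
    exact norm_mul_le a b

instance : NormedSpace ℂ (AlgLimit A f) where
  norm_smul_le c x := by
    induction x using induction with | h i a => ?_
    rw [← map_smul, norm_mk, norm_mk]
    exact norm_smul_le c a

instance : CStarRing (AlgLimit A f) where
  norm_mul_self_le x := by
    induction x using induction with | h i a => ?_
    rw [← map_star, ← map_mul, norm_mk, norm_mk]
    exact CStarRing.norm_mul_self_le a

section lift

variable {B : Type*} [NonUnitalCStarAlgebra B] (φ : ∀ i, A i →⋆ₙₐ[ℂ] B)
  (hφ : ∀ i j h a, φ i a = φ j (f i j h a))

/-- The homomorphism on the direct limit given by a compatible family of homomorphisms. -/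
def lift : AlgLimit A f →⋆ₙₐ[ℂ] B where
  toFun := DirectLimit.lift f (fun i ↦ φ i) hφ
  map_smul' c x := by
    induction x using induction with | h i a => ?_
    rw [← map_smul]
    exact map_smul (φ i) c a
  map_zero' := by
    rw [← map_zero (mk A f (Classical.arbitrary ι))]
    exact map_zero (φ _)
  map_add' x y := by
    induction x, y using induction₂ with | h i a b => ?_
    rw [← map_add]
    exact map_add (φ i) a b
  map_mul' x y := by
    induction x, y using induction₂ with | h i a b => ?_
    rw [← map_mul]
    exact map_mul (φ i) a b
  map_star' x := by
    induction x using induction with | h i a => ?_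
    rw [← map_star]
    exact map_star (φ i) a

theorem lift_mk (i : ι) (a : A i) : lift φ hφ (mk A f i a) = φ i a := rfl

theorem norm_lift (hn : ∀ i a, ‖φ i a‖ = ‖a‖) (x : AlgLimit A f) : ‖lift φ hφ x‖ = ‖x‖ := by
  induction x using induction with | h i a => ?_
  rw [lift_mk, norm_mk, hn]

end lift

end AlgLimit

/-- The C*-inductive limit: the completion of the algebraic direct limit. -/
abbrev CStarLimit : Type _ := CStarCompletion (AlgLimit A f)

end InductiveLimit

/-! ### Two constructions with operators on Hilbert spaces -/

section Hilbert

variable {H K : Type*} [NormedAddCommGroup H] [InnerProductSpace ℂ H] [CompleteSpace H]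
  [NormedAddCommGroup K] [InnerProductSpace ℂ K] [CompleteSpace K]

/-- Conjugation by an isometry `V`: the endomorphism `A ↦ V A V*` of `B(H)`. -/
def conjIsometry (V : H →L[ℂ] H) (hV : star V * V = 1) : (H →L[ℂ] H) →⋆ₙₐ[ℂ] (H →L[ℂ] H) where
  toFun A := V * A * star V
  map_smul' c A := by simp
  map_zero' := by simp
  map_add' A B := by simp [mul_add, add_mul]
  map_mul' A B := by
    calc V * (A * B) * star V
        = V * A * 1 * B * star V := by simp only [mul_one, mul_assoc]
      _ = _ := by rw [← hV]; simp only [mul_assoc]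
  map_star' A := by simp [mul_assoc]

theorem continuous_conjIsometry (V : H →L[ℂ] H) (hV : star V * V = 1) :
    Continuous (conjIsometry V hV) := by
  change Continuous fun A ↦ V * A * star V
  fun_prop

/-- The lifting `A ↦ J A J*` of operators along an isometry `J : H → K`. -/
def liftOp (J : H →ₗᵢ[ℂ] K) : (H →L[ℂ] H) →⋆ₙₐ[ℂ] (K →L[ℂ] K) where
  toFun A := J.toContinuousLinearMap ∘L A ∘L J.toContinuousLinearMap.adjoint
  map_smul' c A := by simp
  map_zero' := by simp
  map_add' A B := by simp
  map_mul' A B := by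
    have h : J.toContinuousLinearMap.adjoint ∘L J.toContinuousLinearMap = 1 :=
      (ContinuousLinearMap.norm_map_iff_adjoint_comp_self _).1 J.norm_map
    ext1 f
    have h' : ∀ v, J.toContinuousLinearMap.adjoint (J v) = v := fun v ↦
      DFunLike.congr_fun h v
    simp [h']
  map_star' A := by
    simp only [ContinuousLinearMap.star_eq_adjoint, ContinuousLinearMap.adjoint_comp,
      ContinuousLinearMap.adjoint_adjoint]
    rfl

theorem norm_liftOp (J : H →ₗᵢ[ℂ] K) (A : H →L[ℂ] H) : ‖liftOp J A‖ = ‖A‖ := by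
  refine NonUnitalStarAlgHom.norm_map (liftOp J) (fun A B h ↦ ?_) A
  have h0 : J.toContinuousLinearMap.adjoint ∘L J.toContinuousLinearMap = 1 :=
    (ContinuousLinearMap.norm_map_iff_adjoint_comp_self _).1 J.norm_map
  have h' : ∀ v, J.toContinuousLinearMap.adjoint (J v) = v := fun v ↦ DFunLike.congr_fun h0 v
  ext1 v
  have := DFunLike.congr_fun h (J v)
  simpa [liftOp, h'] using this

end Hilbert

/-! ### Translations on `L²` of a group -/

section Group

variable {G : Type*} [Group G] [TopologicalSpace G] [IsTopologicalGroup G]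
  [MeasurableSpace G] [BorelSpace G]

/-- The Hilbert space `L²(G)`. -/
abbrev L2 (μ : Measure G) : Type _ := Lp ℂ 2 μ

variable (μ : Measure G)

/-- `H_X`: the functions in `L²(G)` whose essential support lies in `X`. -/
def supportedOn (X : Set G) : Submodule ℂ (L2 μ) where
  carrier := {f | ∀ᵐ x ∂μ, x ∉ X → f x = 0}
  add_mem' {f g} hf hg := by
    filter_upwards [hf, hg, Lp.coeFn_add f g] with x h1 h2 h3 hx
    rw [h3, Pi.add_apply, h1 hx, h2 hx, add_zero]
  zero_mem' := by
    filter_upwards [Lp.coeFn_zero ℂ 2 μ] with x h1 hx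
    rw [h1, Pi.zero_apply]
  smul_mem' c f hf := by
    filter_upwards [hf, Lp.coeFn_smul c f] with x h1 h3 hx
    rw [h3, Pi.smul_apply, h1 hx, smul_zero]

theorem isClosed_supportedOn (X : Set G) : IsClosed (supportedOn μ X : Set (L2 μ)) := by
  refine IsSeqClosed.isClosed fun u f hu hf ↦ ?_
  obtain ⟨ns, -, hns⟩ := (tendstoInMeasure_of_tendsto_Lp hf).exists_seq_tendsto_ae
  filter_upwards [hns, ae_all_iff.2 fun n ↦ hu n] with x h1 h2 hx
  refine tendsto_nhds_unique h1 ?_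
  simp only [h2 _ hx]
  exact tendsto_const_nhds

instance (X : Set G) : CompleteSpace (supportedOn μ X) :=
  (isClosed_supportedOn μ X).completeSpace_coe

/-- `E_X`: the orthogonal projection of `L²(G)` onto `H_X`. -/
def proj (X : Set G) : L2 μ →L[ℂ] L2 μ := (supportedOn μ X).starProjection

variable [μ.IsMulLeftInvariant]

/-- Left translation on `L²(G; E)`: `(translate μ E g f)(x) = f(g⁻¹ x)`. -/
def translate (E : Type*) [NormedAddCommGroup E] [NormedSpace ℂ E] (g : G) :
    Lp E 2 μ →L[ℂ] Lp E 2 μ :=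
  (Lp.compMeasurePreservingₗᵢ ℂ (g⁻¹ * ·)
    (measurePreserving_mul_left μ g⁻¹)).toContinuousLinearMap

/-- The left regular representation `L` of `G` on `L²(G)`. -/
abbrev leftReg (g : G) : L2 μ →L[ℂ] L2 μ := translate μ ℂ g

theorem translate_coeFn (E : Type*) [NormedAddCommGroup E] [NormedSpace ℂ E] (g : G)
    (f : Lp E 2 μ) : translate μ E g f =ᵐ[μ] fun x ↦ f (g⁻¹ * x) :=
  Lp.coeFn_compMeasurePreserving f (measurePreserving_mul_left μ g⁻¹)

theorem translate_one (E : Type*) [NormedAddCommGroup E] [NormedSpace ℂ E] :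
    translate μ E (1 : G) = 1 := by
  ext1 f
  refine Lp.ext ?_
  filter_upwards [translate_coeFn μ E 1 f] with x hx
  simp [hx]

theorem translate_mul (E : Type*) [NormedAddCommGroup E] [NormedSpace ℂ E] (g h : G) :
    translate μ E (g * h) = translate μ E g * translate μ E h := by
  ext1 f
  refine Lp.ext ?_
  filter_upwards [translate_coeFn μ E (g * h) f,
    translate_coeFn μ E g (translate μ E h f),
    (measurePreserving_mul_left μ g⁻¹).quasiMeasurePreserving.ae
      (translate_coeFn μ E h f)] with x h1 h2 h3
  rw [h1, mul_apply_eq_comp, h2, h3, mul_inv_rev, mul_assoc]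

theorem norm_translate_apply (E : Type*) [NormedAddCommGroup E] [NormedSpace ℂ E] (g : G)
    (f : Lp E 2 μ) : ‖translate μ E g f‖ = ‖f‖ :=
  LinearIsometry.norm_map _ f

theorem star_translate (E : Type*) [NormedAddCommGroup E] [InnerProductSpace ℂ E]
    [CompleteSpace E] (g : G) : star (translate μ E g) = translate μ E g⁻¹ := by
  have h : star (translate μ E g) * translate μ E g = 1 := by
    rw [ContinuousLinearMap.star_eq_adjoint]
    exact (ContinuousLinearMap.norm_map_iff_adjoint_comp_self _).1 (norm_translate_apply μ E g)
  calc star (translate μ E g)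
      = star (translate μ E g) * (translate μ E g * translate μ E g⁻¹) := by
        rw [← translate_mul, mul_inv_cancel, translate_one, mul_one]
    _ = translate μ E g⁻¹ := by rw [← mul_assoc, h, one_mul]

end Group
/-! ### The C*-algebras of a subsemigroup -/

/-- The C*-subalgebra of `B` generated by a set: the smallest norm-closed
*-subalgebra (with or without unit) containing it. -/
def cstarGen {B : Type*} [NonUnitalCStarAlgebra B] (s : Set B) : NonUnitalStarSubalgebra ℂ B :=
  (NonUnitalStarAlgebra.adjoin ℂ s).topologicalClosure

theorem subset_cstarGen {B : Type*} [NonUnitalCStarAlgebra B] (s : Set B) :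
    s ⊆ cstarGen s :=
  (NonUnitalStarAlgebra.subset_adjoin ℂ s).trans
    (NonUnitalStarSubalgebra.le_topologicalClosure _)

theorem isClosed_cstarGen {B : Type*} [NonUnitalCStarAlgebra B] (s : Set B) :
    IsClosed (cstarGen s : Set B) :=
  NonUnitalStarSubalgebra.isClosed_topologicalClosure _

theorem cstarGen_le {B : Type*} [NonUnitalCStarAlgebra B] {s : Set B}
    {t : NonUnitalStarSubalgebra ℂ B} (hs : s ⊆ t) (ht : IsClosed (t : Set B)) :
    cstarGen s ≤ t :=
  NonUnitalStarSubalgebra.topologicalClosure_minimal _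
    (NonUnitalStarAlgebra.adjoin_le hs) ht

instance {B : Type*} [NonUnitalCStarAlgebra B] (s : Set B) :
    NonUnitalCStarAlgebra (cstarGen s) :=
  NonUnitalStarSubalgebra.nonUnitalCStarAlgebra _ (h_closed := isClosed_cstarGen s)

section Semigroup

variable {G : Type*} [Group G] [TopologicalSpace G] [IsTopologicalGroup G]
  [MeasurableSpace G] [BorelSpace G]
  (μ : Measure G) [μ.IsMulLeftInvariant] (S : Submonoid G)

/-- The Hilbert space `H_S` of functions in `L²(G)` supported in the semigroup `S`. -/
def HS : Type _ := supportedOn μ (S : Set G)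

instance : NormedAddCommGroup (HS μ S) :=
  inferInstanceAs (NormedAddCommGroup (supportedOn μ (S : Set G)))

instance : InnerProductSpace ℂ (HS μ S) :=
  inferInstanceAs (InnerProductSpace ℂ (supportedOn μ (S : Set G)))

instance : CompleteSpace (HS μ S) :=
  inferInstanceAs (CompleteSpace (supportedOn μ (S : Set G)))

/-- `J_S`, the inclusion of `H_S` into `L²(G)`. -/
def incl : HS μ S →ₗᵢ[ℂ] L2 μ := (supportedOn μ (S : Set G)).subtypeₗᵢ

/-- `E_S` regarded as an operator from `L²(G)` onto `H_S`. -/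
def restr : L2 μ →L[ℂ] HS μ S := (supportedOn μ (S : Set G)).orthogonalProjectionOnto

/-- The operator of translation by `a ∈ S` on `H_S`: `T_a = E_S L_a J_S`. -/
def T (a : S) : HS μ S →L[ℂ] HS μ S :=
  restr μ S ∘L leftReg μ (a : G) ∘L (incl μ S).toContinuousLinearMap

/-- The algebra `C*_δ(S) ⊆ B(H_S)`, generated by the operators `T_a`, `a ∈ S`. -/
def CDelta : NonUnitalStarSubalgebra ℂ (HS μ S →L[ℂ] HS μ S) := cstarGen (Set.range (T μ S))

/-- The operator of a letter: `T_a` for the letter `a` (written `inl a`) and `T_a*` for the letter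
`a⁻¹` (written `inr a`). -/
def letterOp : S ⊕ S → (HS μ S →L[ℂ] HS μ S) := Sum.elim (T μ S) fun a ↦ star (T μ S a)

/-- The monomial `T_w`, for a word `w` in the letters `a`, `a⁻¹` with `a ∈ S`. -/
def monomial (w : List (S ⊕ S)) : HS μ S →L[ℂ] HS μ S := (w.map (letterOp μ S)).prod

/-- The index of a word: its value in the group `G`. -/
def index {G : Type*} [Group G] {S : Submonoid G} (w : List (S ⊕ S)) : G :=
  (w.map (Sum.elim (fun a : S ↦ (a : G)) fun a : S ↦ (a : G)⁻¹)).prod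

/-- The algebra `D_δ(S)`, generated by the monomials of index `e`. -/
def DDelta : NonUnitalStarSubalgebra ℂ (HS μ S →L[ℂ] HS μ S) :=
  cstarGen {A | ∃ w : List (S ⊕ S), index w = 1 ∧ A = monomial μ S w}

/-- `D_δ(S)` as a C*-algebra in its own right. -/
def DAlg : Type _ := DDelta μ S

instance : NonUnitalCStarAlgebra (DAlg μ S) :=
  inferInstanceAs (NonUnitalCStarAlgebra (cstarGen _))

/-- The inclusion of `D_δ(S)` into `B(H_S)`. -/
def DAlg.subtype : DAlg μ S →⋆ₙₐ[ℂ] (HS μ S →L[ℂ] HS μ S) :=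
  NonUnitalStarSubalgebraClass.subtype (DDelta μ S)

theorem DAlg.subtype_injective : Function.Injective (DAlg.subtype μ S) :=
  Subtype.val_injective

theorem translate_mem {a : G} (ha : a ∈ S) {f : L2 μ} (hf : f ∈ supportedOn μ (S : Set G)) :
    leftReg μ a f ∈ supportedOn μ (S : Set G) := by
  have hf' : ∀ᵐ x ∂μ, x ∉ (S : Set G) → f x = 0 := hf
  change ∀ᵐ x ∂μ, x ∉ (S : Set G) → leftReg μ a f x = 0
  filter_upwards [translate_coeFn μ ℂ a f,
    (measurePreserving_mul_left μ a⁻¹).quasiMeasurePreserving.ae hf'] with x h1 h2 hx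
  rw [h1]
  refine h2 fun h ↦ hx ?_
  have := S.mul_mem ha h
  rwa [mul_inv_cancel_left] at this

theorem incl_T (a : S) (f : HS μ S) : incl μ S (T μ S a f) = leftReg μ (a : G) (incl μ S f) :=
  Submodule.starProjection_eq_self_iff.2 (translate_mem μ S a.2 f.2)

theorem T_one : T μ S 1 = 1 := by
  ext1 f
  apply (incl μ S).injective
  rw [incl_T, Submonoid.coe_one, leftReg, translate_one]
  rfl

theorem T_mul (a b : S) : T μ S (a * b) = T μ S a * T μ S b := by
  ext1 f
  apply (incl μ S).injective
  rw [mul_apply_eq_comp, incl_T, incl_T, incl_T, Submonoid.coe_mul, leftReg, translate_mul]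
  rfl

theorem star_T_mul_T (a : S) : star (T μ S a) * T μ S a = 1 := by
  refine (ContinuousLinearMap.norm_map_iff_adjoint_comp_self _).1 fun f ↦ ?_
  rw [← (incl μ S).norm_map, incl_T, leftReg, norm_translate_apply, (incl μ S).norm_map]

theorem conj_monomial (p : S) (w : List (S ⊕ S)) :
    conjIsometry (T μ S p) (star_T_mul_T μ S p) (monomial μ S w) =
      monomial μ S (Sum.inl p :: (w ++ [Sum.inr p])) := by
  simp [conjIsometry, monomial, letterOp, mul_assoc]

theorem conj_mem (p : S) {A : HS μ S →L[ℂ] HS μ S} (hA : A ∈ DDelta μ S) :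
    conjIsometry (T μ S p) (star_T_mul_T μ S p) A ∈ DDelta μ S := by
  have h : DDelta μ S ≤
      (DDelta μ S).comap (conjIsometry (T μ S p) (star_T_mul_T μ S p)) := by
    refine cstarGen_le ?_ ?_
    · rintro _ ⟨w, hw, rfl⟩
      refine subset_cstarGen _ ⟨_, ?_, conj_monomial μ S p w⟩
      simp only [index] at hw
      simp [index, hw]
    · have hcl : IsClosed (DDelta μ S : Set (HS μ S →L[ℂ] HS μ S)) := isClosed_cstarGen _
      exact hcl.preimage (continuous_conjIsometry _ (star_T_mul_T μ S p))
  exact h hA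

/-- The action `τ_p(A) = T_p A T_p*` of `p ∈ S` on `D_δ(S)`. -/
def act (p : S) : DAlg μ S →⋆ₙₐ[ℂ] DAlg μ S :=
  NonUnitalStarAlgHom.codRestrict ((conjIsometry (T μ S p) (star_T_mul_T μ S p)).comp
    (DAlg.subtype μ S)) (DDelta μ S) fun A ↦ conj_mem μ S p A.2

theorem subtype_act (p : S) (A : DAlg μ S) :
    DAlg.subtype μ S (act μ S p A) = T μ S p * DAlg.subtype μ S A * star (T μ S p) := rfl

theorem act_one (A : DAlg μ S) : act μ S 1 A = A := by
  apply DAlg.subtype_injective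
  simp [subtype_act, T_one]

theorem act_mul (p q : S) (A : DAlg μ S) : act μ S (p * q) A = act μ S p (act μ S q A) := by
  apply DAlg.subtype_injective
  simp [subtype_act, T_mul, mul_assoc]

theorem act_injective (p : S) : Function.Injective (act μ S p) := by
  intro A B h
  have key : ∀ C : DAlg μ S,
      star (T μ S p) * DAlg.subtype μ S (act μ S p C) * T μ S p = DAlg.subtype μ S C := fun C ↦ by
    rw [subtype_act]
    calc star (T μ S p) * (T μ S p * DAlg.subtype μ S C * star (T μ S p)) * T μ S p
        = (star (T μ S p) * T μ S p) * DAlg.subtype μ S C *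
          (star (T μ S p) * T μ S p) := by simp only [mul_assoc]
      _ = _ := by rw [star_T_mul_T, one_mul, mul_one]
  apply DAlg.subtype_injective
  rw [← key A, ← key B, h]

end Semigroup
/-! ### The inductive limit of the algebras `D_δ(S)` -/

/-- The submonoid `S` satisfies `G = S⁻¹S`. -/
class LeftGenerates {G : Type*} [Group G] (S : Submonoid G) : Prop where
  exists_eq : ∀ g : G, ∃ p ∈ S, ∃ q ∈ S, g = p⁻¹ * q

/-- The semigroup `S` as an index set, ordered by `p ≤ q` if and only if `q p⁻¹ ∈ S`. -/
def Index {G : Type*} [Group G] (S : Submonoid G) : Type _ := S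

namespace Index

variable {G : Type*} [Group G] {S : Submonoid G}

/-- The element of `S` behind an index. -/
def val (p : Index S) : S := p

instance : Nonempty (Index S) := ⟨(1 : S)⟩

instance : Preorder (Index S) where
  le p q := (q.val : G) * (p.val : G)⁻¹ ∈ S
  le_refl p := by simp
  le_trans p q r h1 h2 := by simpa [mul_assoc] using S.mul_mem h2 h1

theorem le_iff {p q : Index S} : p ≤ q ↔ (q.val : G) * (p.val : G)⁻¹ ∈ S := Iff.rfl

/-- The element `q p⁻¹` of `S`, for `p ≤ q`. -/
def ratio {p q : Index S} (h : p ≤ q) : S := ⟨(q.val : G) * (p.val : G)⁻¹, h⟩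

instance [LeftGenerates S] : IsDirectedOrder (Index S) where
  directed p q := by
    obtain ⟨a, ha, b, hb, h⟩ := LeftGenerates.exists_eq (S := S) ((p.val : G) * (q.val : G)⁻¹)
    let r : Index S := (⟨a * p.val, S.mul_mem ha p.val.2⟩ : S)
    refine ⟨r, ?_, ?_⟩
    · change a * (p.val : G) * (p.val : G)⁻¹ ∈ S
      simpa using ha
    · change a * (p.val : G) * (q.val : G)⁻¹ ∈ S
      rw [mul_assoc, h]
      simpa using hb

end Index

section Limit

variable {G : Type*} [Group G] [TopologicalSpace G] [IsTopologicalGroup G]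
  [MeasurableSpace G] [BorelSpace G]
  (μ : Measure G) [μ.IsMulLeftInvariant] (S : Submonoid G)

/-- The connecting map `τ_{qp⁻¹}` of the directed system, from the copy of `D_δ(S)` at `p` to
the copy at `q`, for `p ≤ q`. -/
def conn (p q : Index S) (h : p ≤ q) : DAlg μ S →⋆ₙₐ[ℂ] DAlg μ S := act μ S (Index.ratio h)

instance : DirectedSystem (fun _ : Index S ↦ DAlg μ S) (conn μ S · · ·) where
  map_self p A := by
    have : Index.ratio (le_refl p) = 1 := Subtype.ext (mul_inv_cancel _)
    simp only [conn, this, act_one]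
  map_map r q p h1 h2 A := by
    have : Index.ratio (h1.trans h2) = Index.ratio h2 * Index.ratio h1 := by
      apply Subtype.ext
      simp [Index.ratio, mul_assoc]
    simp only [conn, this, act_mul]

instance : Fact (∀ p q h, Function.Injective (conn μ S p q h)) :=
  ⟨fun _ _ _ ↦ act_injective μ S _⟩

/-- The homomorphism `φ_p(A) = L_p* J_S A E_S L_p` from `D_δ(S)` to `B(L²(G))`. -/
def phi (p : Index S) : DAlg μ S →⋆ₙₐ[ℂ] (L2 μ →L[ℂ] L2 μ) :=
  (conjIsometry (star (leftReg μ (p.val : G))) (by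
    rw [star_star, star_translate, ← translate_mul, mul_inv_cancel, translate_one])).comp
    ((liftOp (incl μ S)).comp (DAlg.subtype μ S))

theorem phi_apply (p : Index S) (A : DAlg μ S) :
    phi μ S p A = leftReg μ (p.val : G)⁻¹ * liftOp (incl μ S) (DAlg.subtype μ S A) *
      leftReg μ (p.val : G) := by
  change star (leftReg μ (p.val : G)) * _ * star (star (leftReg μ (p.val : G))) = _
  rw [star_star, star_translate]
  rfl

theorem leftReg_mul_incl (p : S) :
    leftReg μ (p : G) ∘L (incl μ S).toContinuousLinearMap =
      (incl μ S).toContinuousLinearMap ∘L T μ S p := by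
  ext1 f
  exact (incl_T μ S p f).symm

/-- `L_s (J_S A E_S) L_s* = J_S (T_s A T_s*) E_S`. -/
theorem leftReg_conj_liftOp (s : S) (A : DAlg μ S) :
    leftReg μ (s : G) * liftOp (incl μ S) (DAlg.subtype μ S A) * leftReg μ (s : G)⁻¹ =
      liftOp (incl μ S) (DAlg.subtype μ S (act μ S s A)) := by
  have h := congrArg ContinuousLinearMap.adjoint (leftReg_mul_incl μ S s)
  rw [ContinuousLinearMap.adjoint_comp, ContinuousLinearMap.adjoint_comp,
    ← ContinuousLinearMap.star_eq_adjoint (leftReg μ (s : G)), star_translate] at h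
  rw [subtype_act]
  change leftReg μ (s : G) ∘L ((incl μ S).toContinuousLinearMap ∘L DAlg.subtype μ S A ∘L
    (incl μ S).toContinuousLinearMap.adjoint) ∘L leftReg μ (s : G)⁻¹ =
    (incl μ S).toContinuousLinearMap ∘L ((T μ S s ∘L DAlg.subtype μ S A) ∘L
      (T μ S s).adjoint) ∘L (incl μ S).toContinuousLinearMap.adjoint
  simp only [ContinuousLinearMap.comp_assoc]
  rw [← h]
  simp only [← ContinuousLinearMap.comp_assoc]
  rw [leftReg_mul_incl]

theorem phi_conn (p q : Index S) (h : p ≤ q) (A : DAlg μ S) :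
    phi μ S p A = phi μ S q (conn μ S p q h A) := by
  rw [phi_apply, phi_apply, conn, ← leftReg_conj_liftOp]
  simp only [Index.ratio, mul_inv_rev, inv_inv, leftReg, translate_mul, ← mul_assoc]
  rw [← translate_mul, inv_mul_cancel, translate_one, one_mul, mul_assoc _ (translate μ ℂ _⁻¹),
    ← translate_mul, inv_mul_cancel, translate_one, mul_one]

theorem norm_phi (p : Index S) (A : DAlg μ S) : ‖phi μ S p A‖ = ‖A‖ := by
  refine NonUnitalStarAlgHom.norm_map (phi μ S p) (fun A B h ↦ ?_) A
  rw [phi_apply, phi_apply] at h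
  have h' := congrArg (fun C ↦ leftReg μ (p.val : G) * C * leftReg μ (p.val : G)⁻¹) h
  have key : ∀ C, leftReg μ (p.val : G) * (leftReg μ (p.val : G)⁻¹ * C *
      leftReg μ (p.val : G)) * leftReg μ (p.val : G)⁻¹ = C := fun C ↦ by
    simp only [leftReg, mul_assoc]
    rw [← translate_mul, mul_inv_cancel, translate_one, mul_one, ← mul_assoc,
      ← translate_mul, mul_inv_cancel, translate_one, one_mul]
  rw [key, key] at h'
  apply DAlg.subtype_injective
  rw [← sub_eq_zero, ← norm_eq_zero, ← norm_liftOp (incl μ S), map_sub, h', sub_self, norm_zero]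

variable [LeftGenerates S]

/-- The C*-inductive limit `D_δ^(∞)(S)` of the directed system `(D_δ(S), τ_{qp⁻¹})`. -/
def DInf : Type _ := CStarLimit (fun _ : Index S ↦ DAlg μ S) (conn μ S)

instance : NonUnitalCStarAlgebra (DInf μ S) :=
  inferInstanceAs (NonUnitalCStarAlgebra (CStarLimit (fun _ : Index S ↦ DAlg μ S) (conn μ S)))

/-- The canonical map of the copy of `D_δ(S)` at `p` into the inductive limit. -/
def toDInf (p : Index S) (A : DAlg μ S) : DInf μ S :=
  CStarCompletion.of (AlgLimit.mk (fun _ : Index S ↦ DAlg μ S) (conn μ S) p A)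

/-- The representation `Φ = lim φ_p` of `D_δ^(∞)(S)` on `L²(G)`. -/
def Phi : DInf μ S →⋆ₙₐ[ℂ] (L2 μ →L[ℂ] L2 μ) :=
  CStarCompletion.lift (AlgLimit.lift (phi μ S) (phi_conn μ S))
    (AlgLimit.norm_lift _ _ (norm_phi μ S))

theorem Phi_toDInf (p : Index S) (A : DAlg μ S) : Phi μ S (toDInf μ S p A) = phi μ S p A :=
  CStarCompletion.lift_of _ _ _

theorem norm_Phi (u : DInf μ S) : ‖Phi μ S u‖ = ‖u‖ := CStarCompletion.norm_lift _ _ u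

theorem Phi_injective : Function.Injective (Phi μ S) :=
  (AddMonoidHomClass.isometry_of_norm (Phi μ S) (norm_Phi μ S)).injective

theorem DInf_induction {p : DInf μ S → Prop} (u : DInf μ S) (hp : IsClosed {u | p u})
    (h : ∀ q A, p (toDInf μ S q A)) : p u := by
  refine CStarCompletion.induction_on (p := p) u hp fun x ↦ ?_
  induction x using AlgLimit.induction with | h i a => exact h i a

/-- The range of `Φ` is invariant under conjugation by the left regular representation. -/
theorem exists_Phi_eq (g : G) (u : DInf μ S) :
    ∃ v, Phi μ S v = leftReg μ g * Phi μ S u * star (leftReg μ g) := by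
  have hiso := AddMonoidHomClass.isometry_of_norm (Phi μ S) (norm_Phi μ S)
  have hcl : IsClosed (Set.range (Phi μ S)) := hiso.isClosedEmbedding.isClosed_range
  change leftReg μ g * Phi μ S u * star (leftReg μ g) ∈ Set.range (Phi μ S)
  refine DInf_induction μ S
    (p := fun u ↦ leftReg μ g * Phi μ S u * star (leftReg μ g) ∈ Set.range (Phi μ S))
    u ?_ fun q A ↦ ?_
  · exact hcl.preimage ((continuous_const.mul hiso.continuous).mul continuous_const)
  · obtain ⟨t, ht, s, hs, h⟩ := LeftGenerates.exists_eq (S := S) (g * (q.val : G)⁻¹)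
    let t' : Index S := (⟨t, ht⟩ : S)
    refine ⟨toDInf μ S t' (act μ S ⟨s, hs⟩ A), ?_⟩
    rw [Phi_toDInf, Phi_toDInf, phi_apply, phi_apply, ← leftReg_conj_liftOp, star_translate]
    have h2 : (q.val : G) * g⁻¹ = s⁻¹ * t := by
      rw [← inv_inj, mul_inv_rev, inv_inv, h, mul_inv_rev, inv_inv]
    have e1 : leftReg μ g * leftReg μ (q.val : G)⁻¹ = leftReg μ t⁻¹ * leftReg μ s := by
      simp only [leftReg, ← translate_mul, h]
    have e2 : leftReg μ (q.val : G) * leftReg μ g⁻¹ = leftReg μ s⁻¹ * leftReg μ t := by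
      simp only [leftReg, ← translate_mul, h2]
    set X := liftOp (incl μ S) (DAlg.subtype μ S A)
    change leftReg μ t⁻¹ * (leftReg μ s * X * leftReg μ s⁻¹) * leftReg μ t =
      leftReg μ g * (leftReg μ (q.val : G)⁻¹ * X * leftReg μ (q.val : G)) * leftReg μ g⁻¹
    calc _ = (leftReg μ t⁻¹ * leftReg μ s) * X * (leftReg μ s⁻¹ * leftReg μ t) := by
          simp only [mul_assoc]
      _ = _ := by rw [← e1, ← e2]; simp only [mul_assoc]

/-- The action `τ` of `G` on `D_δ^(∞)(S)`: `τ(g)u = Φ⁻¹(L_g Φ(u) L_g*)`. -/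
def tau (g : G) (u : DInf μ S) : DInf μ S := (exists_Phi_eq μ S g u).choose

theorem Phi_tau (g : G) (u : DInf μ S) :
    Phi μ S (tau μ S g u) = leftReg μ g * Phi μ S u * star (leftReg μ g) :=
  (exists_Phi_eq μ S g u).choose_spec

end Limit

/-! ### The regular representation and the reduced crossed product -/

section Regular

variable {G : Type*} [Group G] [TopologicalSpace G] [IsTopologicalGroup G] [T2Space G]
  [MeasurableSpace G] [BorelSpace G] (μ : Measure G)
  {H : Type*} [NormedAddCommGroup H] [InnerProductSpace ℂ H]

/-- Strongly continuous functions are strongly measurable on sets of finite Haar measure. -/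
theorem aestronglyMeasurable_restrict [μ.InnerRegularCompactLTTop] {f : G → H}
    (hf : Continuous f) {s : Set G} (hs : MeasurableSet s) (hμ : μ s ≠ ∞) :
    AEStronglyMeasurable f (μ.restrict s) := by
  choose K hKs hK hlt using fun n : ℕ ↦ hs.exists_isCompact_sdiff_lt hμ
    (ε := ((n : ℝ≥0∞) + 1)⁻¹) (by simp)
  have h0 : μ (s \ ⋃ n, K n) = 0 := by
    refine le_antisymm (ge_of_tendsto' (f := fun n : ℕ ↦ ((n : ℝ≥0∞) + 1)⁻¹) (x := atTop) ?_
      fun n ↦ ?_) zero_le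
    · have := (ENNReal.tendsto_inv_nat_nhds_zero).comp (tendsto_add_atTop_nat 1)
      simpa [Function.comp_def] using this
    · exact (measure_mono (Set.sdiff_subset_sdiff_right (Set.subset_iUnion K n))).trans (hlt n).le
  have hae : s =ᵐ[μ] ⋃ n, K n := by
    refine Filter.EventuallyLE.antisymm ?_ (Set.iUnion_subset hKs).eventuallyLE
    exact ae_le_set.2 h0
  rw [Measure.restrict_congr_set hae, aestronglyMeasurable_iUnion_iff]
  exact fun n ↦ hf.continuousOn.aestronglyMeasurable_of_isCompact (hK n) (hK n).measurableSet

/-- A strongly continuous field of operators maps square integrable functions to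
strongly measurable functions. -/
theorem aestronglyMeasurable_field [μ.InnerRegularCompactLTTop] {A : G → H →L[ℂ] H}
    (hA : ∀ v, Continuous fun h ↦ A h v) (ξ : Lp H 2 μ) :
    AEStronglyMeasurable (fun h ↦ A h (ξ h)) μ := by
  refine Lp.induction (p := 2) (by simp)
    (motive := fun ξ : Lp H 2 μ ↦ AEStronglyMeasurable (fun h ↦ A h (ξ h)) μ) ?_ ?_ ?_ ξ
  · intro c s hs hμ
    have h1 : AEStronglyMeasurable (s.indicator fun h ↦ A h c) μ := by
      rw [aestronglyMeasurable_indicator_iff hs]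
      exact aestronglyMeasurable_restrict μ (hA c) hs hμ.ne
    refine h1.congr ?_
    rw [Lp.simpleFunc.coe_indicatorConst]
    filter_upwards [indicatorConstLp_coeFn (p := 2) (hs := hs) (hμs := hμ.ne) (c := c)] with x hx
    rw [hx]
    by_cases h : x ∈ s <;> simp [h]
  · intro f g hf hg hdis h1 h2
    refine (h1.add h2).congr ?_
    filter_upwards [Lp.coeFn_add (hf.toLp f) (hg.toLp g)] with x hx
    simp only [Pi.add_apply] at hx ⊢
    rw [hx, map_add]
  · refine IsSeqClosed.isClosed fun u f hu hf ↦ ?_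
    obtain ⟨ns, -, hns⟩ := (tendstoInMeasure_of_tendsto_Lp hf).exists_seq_tendsto_ae
    refine aestronglyMeasurable_of_tendsto_ae atTop (fun n ↦ hu (ns n)) ?_
    filter_upwards [hns] with x hx
    exact ((A x).continuous.tendsto _).comp hx

theorem memLp_field [μ.InnerRegularCompactLTTop] {A : G → H →L[ℂ] H}
    (hA : ∀ v, Continuous fun h ↦ A h v) {C : ℝ} (hC : ∀ h, ‖A h‖ ≤ C) (ξ : Lp H 2 μ) :
    MemLp (fun h ↦ A h (ξ h)) 2 μ :=
  (Lp.memLp ξ).of_le_mul (aestronglyMeasurable_field μ hA ξ)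
    (ae_of_all _ fun h ↦ (A h).le_of_opNorm_le (hC h) _)

/-- The operator on `L²(G; H)` given by a bounded strongly continuous field of operators on `H`:
it maps `ξ` to `h ↦ A h (ξ h)`. -/
def fieldOp [μ.InnerRegularCompactLTTop] (A : G → H →L[ℂ] H)
    (hA : ∀ v, Continuous fun h ↦ A h v) (C : ℝ) (hC : ∀ h, ‖A h‖ ≤ C) :
    Lp H 2 μ →L[ℂ] Lp H 2 μ :=
  LinearMap.mkContinuous
    { toFun := fun ξ ↦ (memLp_field μ hA hC ξ).toLp _
      map_add' := fun ξ η ↦ by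
        refine Lp.ext ?_
        filter_upwards [(memLp_field μ hA hC (ξ + η)).coeFn_toLp,
          (memLp_field μ hA hC ξ).coeFn_toLp, (memLp_field μ hA hC η).coeFn_toLp,
          Lp.coeFn_add ((memLp_field μ hA hC ξ).toLp _) ((memLp_field μ hA hC η).toLp _),
          Lp.coeFn_add ξ η] with x h1 h2 h3 h4 h5
        rw [h1, h4, Pi.add_apply, h2, h3, h5, Pi.add_apply, map_add]
      map_smul' := fun c ξ ↦ by
        refine Lp.ext ?_
        filter_upwards [(memLp_field μ hA hC (c • ξ)).coeFn_toLp,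
          (memLp_field μ hA hC ξ).coeFn_toLp,
          Lp.coeFn_smul c ((memLp_field μ hA hC ξ).toLp _),
          Lp.coeFn_smul c ξ] with x h1 h2 h4 h5
        rw [h1, RingHom.id_apply, h4, Pi.smul_apply, h2, h5, Pi.smul_apply, map_smul] }
    C fun ξ ↦ Lp.norm_le_mul_norm_of_ae_le_mul (by
      filter_upwards [(memLp_field μ hA hC ξ).coeFn_toLp] with x h1
      change ‖((memLp_field μ hA hC ξ).toLp _ : G → H) x‖ ≤ _
      rw [h1]
      exact (A x).le_of_opNorm_le (hC x) _)

theorem fieldOp_coeFn [μ.InnerRegularCompactLTTop] (A : G → H →L[ℂ] H)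
    (hA : ∀ v, Continuous fun h ↦ A h v) (C : ℝ) (hC : ∀ h, ‖A h‖ ≤ C) (ξ : Lp H 2 μ) :
    fieldOp μ A hA C hC ξ =ᵐ[μ] fun h ↦ A h (ξ h) :=
  (memLp_field μ hA hC ξ).coeFn_toLp

end Regular

section CrossedProduct

variable {G : Type*} [Group G] [TopologicalSpace G] [IsTopologicalGroup G] [T2Space G]
  [LocallyCompactSpace G] [MeasurableSpace G] [BorelSpace G]
  (μ : Measure G) [μ.IsHaarMeasure] [μ.Regular] (S : Submonoid G) [LeftGenerates S]

theorem continuous_leftReg : Continuous fun p : G × L2 μ ↦ leftReg μ p.1 p.2 := by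
  have : Fact ((2 : ℝ≥0∞) ≠ ∞) := ⟨ENNReal.ofNat_ne_top⟩
  have : SMulInvariantMeasure G G μ := inferInstance
  have h : Continuous fun p : G × L2 μ ↦ (DomMulAct.mk p.1⁻¹ : Gᵈᵐᵃ) • p.2 :=
    ((DomMulAct.mkHomeomorph.continuous.comp (continuous_inv.comp continuous_fst))).smul
      continuous_snd
  exact h

theorem continuous_leftReg_comp {a : G → G} {b : G → L2 μ} (ha : Continuous a)
    (hb : Continuous b) : Continuous fun h : G ↦ leftReg μ (a h) (b h) :=
  Continuous.comp (g := fun p : G × L2 μ ↦ leftReg μ p.1 p.2) (f := fun h ↦ (a h, b h))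
    (continuous_leftReg μ) (ha.prodMk hb)

theorem continuous_Phi_tau (u : DInf μ S) (v : L2 μ) :
    Continuous fun h : G ↦ Phi μ S (tau μ S h⁻¹ u) v := by
  have h1 : Continuous fun h : G ↦ leftReg μ h v :=
    continuous_leftReg_comp μ continuous_id continuous_const
  have h3 : Continuous fun h : G ↦ Phi μ S u (leftReg μ h v) :=
    (ContinuousLinearMap.continuous (Phi μ S u)).comp h1
  have h2 : Continuous fun h : G ↦ leftReg μ h⁻¹ (Phi μ S u (leftReg μ h v)) :=
    continuous_leftReg_comp μ continuous_inv h3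
  refine h2.congr fun h ↦ ?_
  rw [Phi_tau, star_translate, inv_inv]
  rfl

theorem norm_Phi_tau (u : DInf μ S) (h : G) : ‖Phi μ S (tau μ S h u)‖ ≤ ‖u‖ := by
  rw [Phi_tau, star_translate, ← norm_Phi μ S u]
  refine ContinuousLinearMap.opNorm_le_bound _ (norm_nonneg _) fun f ↦ ?_
  rw [mul_apply_eq_comp, mul_apply_eq_comp, norm_translate_apply]
  refine ((Phi μ S u).le_opNorm _).trans ?_
  rw [norm_translate_apply]

/-- The Hilbert space `L²(G; L²(G))` of the regular representation. -/
abbrev L2L2 : Type _ := Lp (L2 μ) 2 μ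

/-- The representation of `D_δ^(∞)(S)` on `L²(G; L²(G))` induced from `Φ`:
`(indPhi u ξ)(h) = Φ(τ(h⁻¹)u) ξ(h)`. -/
def indPhi (u : DInf μ S) : L2L2 μ →L[ℂ] L2L2 μ :=
  fieldOp μ (fun h ↦ Phi μ S (tau μ S h⁻¹ u)) (continuous_Phi_tau μ S u) ‖u‖
    fun h ↦ norm_Phi_tau μ S u h⁻¹

theorem indPhi_coeFn (u : DInf μ S) (ξ : L2L2 μ) :
    indPhi μ S u ξ =ᵐ[μ] fun h ↦ Phi μ S (tau μ S h⁻¹ u) (ξ h) :=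
  fieldOp_coeFn μ _ _ _ _ ξ

/-- The unitary representation of `G` on `L²(G; L²(G))` by translation:
`(indL g ξ)(h) = ξ(g⁻¹ h)`. -/
def indL (g : G) : L2L2 μ →L[ℂ] L2L2 μ := translate μ (L2 μ) g

/-- The reduced crossed product `D_δ^(∞)(S) ⋊_{r,τ} G`: the C*-algebra on `L²(G; L²(G))`
generated by the products `u · g`, `u ∈ D_δ^(∞)(S)`, `g ∈ G`, in the regular representation
`(indPhi, indL)`. -/
def crossedProduct : NonUnitalStarSubalgebra ℂ (L2L2 μ →L[ℂ] L2L2 μ) :=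
  cstarGen {B | ∃ (u : DInf μ S) (g : G), B = indPhi μ S u * indL μ g}

/-- The element `u · g` of the reduced crossed product. -/
def crossedProduct.mk (u : DInf μ S) (g : G) : crossedProduct μ S :=
  ⟨indPhi μ S u * indL μ g, subset_cstarGen _ ⟨u, g, rfl⟩⟩

end CrossedProduct

end SemigroupCStar

end

/-! Everything rests on a grading of operators on L²(G) by G. Write M_φ for multiplication by a
bounded continuous φ, and call X homogeneous of degree g if X M_φ = M_{φ(g⁻¹·)} X. The projection
E_S has degree e and L_g has degree g, so a monomial T_w, carried to L²(G), has degree equal to its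
index. Hence every Φ(u) commutes with all M_φ, and X = Φ(u)L_g has degree g.

Conjugating by the unitary ξ ↦ (h ↦ L_h* ξ(h)) turns the generator u·g of the crossed product into
λ_g ⊗ X, where λ_g is translation in the variable h. The grading now links λ_g ⊗ X with X in two
ways.

Existence of π. For a in C_c(G) of norm one in L²(G), the map f ↦ (h ↦ a(x⁻¹h) f(x)) is an isometry,
and homogeneity makes it intertwine X with λ_g ⊗ X (`generator_slice`). So L²(G) sits inside L²(G;
L²(G)) as an invariant subspace of the crossed product, on which u·g acts as Φ(u)L_g; π is the
compression to it.

Injectivity of π. This is Fell absorption: a ⊗ v ↦ (h ↦ a(xh) v(x)) extends to an isometry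
intertwining λ_g ⊗ X with 1 ⊗ X. It therefore carries A, after the conjugation above, to 1 ⊗ π(A),
and π(A) = 0 forces A = 0 (`crossedRep_injective`).

Corner. Ψ extends operators on H_S by zero to L²(G). Since E_S = Φ(1) for the unit at index e,
Ψ(T_a) = E_S L_a E_S lies in the range of π. Conversely, G = S⁻¹S lets one write qg = s⁻¹t, and then
E_S φ_q(A) L_g E_S = Ψ(T_q* A T_s* T_t). Isometric *-homomorphisms have closed range, so both
inclusions pass to norm limits. -/

noncomputable section
namespace SemigroupCStar

open scoped BoundedContinuousFunction InnerProductSpace CompactlySupported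

/-! ### Multiplication operators and the grading of operators on L²(G) -/

section Multiplication

variable {G : Type*} [Group G] [TopologicalSpace G] [IsTopologicalGroup G] [T2Space G]
  [MeasurableSpace G] [BorelSpace G] (μ : Measure G) [μ.InnerRegularCompactLTTop]

/-- The operator on `L²(G)` of multiplication by a bounded continuous function. -/
def mulOp (φ : G →ᵇ ℂ) : L2 μ →L[ℂ] L2 μ :=
  fieldOp μ (fun x ↦ φ x • (1 : ℂ →L[ℂ] ℂ))
    (fun v ↦ φ.continuous.smul continuous_const) ‖φ‖ fun x ↦ by
      rw [norm_smul, norm_one, mul_one]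
      exact φ.norm_coe_le_norm x

theorem mulOp_coeFn (φ : G →ᵇ ℂ) (f : L2 μ) : mulOp μ φ f =ᵐ[μ] fun x ↦ φ x * f x :=
  fieldOp_coeFn μ _ _ _ _ f

theorem star_mulOp (φ : G →ᵇ ℂ) : star (mulOp μ φ) = mulOp μ (star φ) := by
  symm
  rw [ContinuousLinearMap.star_eq_adjoint, ContinuousLinearMap.eq_adjoint_iff]
  intro f g
  rw [L2.inner_def, L2.inner_def]
  refine integral_congr_ae ?_
  filter_upwards [mulOp_coeFn μ φ g, mulOp_coeFn μ (star φ) f] with x h1 h2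
  rw [h1, h2]
  simp
  ring

theorem mulOp_mem_supportedOn (φ : G →ᵇ ℂ) {X : Set G} {f : L2 μ} (hf : f ∈ supportedOn μ X) :
    mulOp μ φ f ∈ supportedOn μ X := by
  have hf' : ∀ᵐ x ∂μ, x ∉ X → f x = 0 := hf
  change ∀ᵐ x ∂μ, x ∉ X → mulOp μ φ f x = 0
  filter_upwards [hf', mulOp_coeFn μ φ f] with x h1 h2 hx
  rw [h2, h1 hx, mul_zero]

theorem proj_mul_mulOp_mul_proj (φ : G →ᵇ ℂ) (X : Set G) :
    proj μ X * mulOp μ φ * proj μ X = mulOp μ φ * proj μ X := by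
  ext1 f
  exact Submodule.starProjection_eq_self_iff.2
    (mulOp_mem_supportedOn μ φ (Submodule.starProjection_apply_mem (supportedOn μ X) f))

theorem star_proj (X : Set G) : star (proj μ X) = proj μ X :=
  (isSelfAdjoint_starProjection (supportedOn μ X)).star_eq

/-- Multiplication preserves supports, and its adjoint is again a multiplication, so the functions
supported in `X` form a reducing subspace. -/
theorem proj_mul_mulOp (φ : G →ᵇ ℂ) (X : Set G) :
    proj μ X * mulOp μ φ = mulOp μ φ * proj μ X := by
  have h := congrArg star (proj_mul_mulOp_mul_proj μ (star φ) X)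
  simp only [star_mul, star_proj, star_mulOp, star_star] at h
  rw [← h, ← mul_assoc, proj_mul_mulOp_mul_proj]

theorem norm_mulOp_apply_le (φ : G →ᵇ ℂ) (f : L2 μ) {C : ℝ}
    (h : ∀ᵐ x ∂μ, ‖φ x * f x‖ ≤ C * ‖f x‖) : ‖mulOp μ φ f‖ ≤ C * ‖f‖ := by
  refine Lp.norm_le_mul_norm_of_ae_le_mul ?_
  filter_upwards [h, mulOp_coeFn μ φ f] with x h1 h2
  rwa [h2]

theorem mulOp_sub_apply (φ ψ : G →ᵇ ℂ) (f : L2 μ) :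
    mulOp μ (φ - ψ) f = mulOp μ φ f - mulOp μ ψ f := by
  refine Lp.ext ?_
  filter_upwards [mulOp_coeFn μ φ f, mulOp_coeFn μ ψ f, mulOp_coeFn μ (φ - ψ) f,
    Lp.coeFn_sub (mulOp μ φ f) (mulOp μ ψ f)] with x h1 h2 h3 h4
  rw [h4, Pi.sub_apply, h1, h2, h3, BoundedContinuousFunction.sub_apply, sub_mul]

/-- The left translate `x ↦ φ (g⁻¹ x)` of a bounded continuous function. -/
def translateFun (g : G) (φ : G →ᵇ ℂ) : G →ᵇ ℂ :=
  φ.compContinuous ⟨fun x ↦ g⁻¹ * x, by fun_prop⟩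

theorem translateFun_apply (g : G) (φ : G →ᵇ ℂ) (x : G) :
    translateFun g φ x = φ (g⁻¹ * x) := rfl

theorem translateFun_one (φ : G →ᵇ ℂ) : translateFun (1 : G) φ = φ := by
  ext x
  simp [translateFun_apply]

theorem translateFun_mul (g h : G) (φ : G →ᵇ ℂ) :
    translateFun (g * h) φ = translateFun g (translateFun h φ) := by
  ext x
  simp [translateFun_apply, mul_assoc]

theorem translateFun_star (g : G) (φ : G →ᵇ ℂ) :
    translateFun g (star φ) = star (translateFun g φ) := rfl

/-- An operator `X` on `L²(G)` is homogeneous of degree `g` if it intertwines multiplication by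
every bounded continuous function with multiplication by its translate by `g`. -/
def IsHomogeneous (g : G) (X : L2 μ →L[ℂ] L2 μ) : Prop :=
  ∀ φ : G →ᵇ ℂ, X * mulOp μ φ = mulOp μ (translateFun g φ) * X

namespace IsHomogeneous

variable {μ} {g h : G} {X Y : L2 μ →L[ℂ] L2 μ}

theorem apply (hX : IsHomogeneous μ g X) (φ : G →ᵇ ℂ) (f : L2 μ) :
    X (mulOp μ φ f) = mulOp μ (translateFun g φ) (X f) :=
  DFunLike.congr_fun (hX φ) f

/-- Together with `star`, this makes the degree behave like a group element, so the degree of a word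
in the T_a and T_a* can be read off letter by letter. -/
theorem mul (hX : IsHomogeneous μ g X) (hY : IsHomogeneous μ h Y) :
    IsHomogeneous μ (g * h) (X * Y) := fun φ ↦ by
  rw [mul_assoc, hY, ← mul_assoc, hX, mul_assoc, translateFun_mul]

theorem star (hX : IsHomogeneous μ g X) : IsHomogeneous μ g⁻¹ (star X) := fun φ ↦ by
  have h := congrArg Star.star (hX (translateFun g⁻¹ (Star.star φ)))
  rw [← translateFun_mul, mul_inv_cancel, translateFun_one] at h
  simp only [star_mul, star_mulOp, translateFun_star, star_star] at h
  exact h.symm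

theorem of_proj (Z : Set G) : IsHomogeneous μ 1 (proj μ Z) := fun φ ↦ by
  rw [translateFun_one, proj_mul_mulOp]

theorem leftReg [μ.IsMulLeftInvariant] (g : G) : IsHomogeneous μ g (leftReg μ g) := fun φ ↦ by
  ext1 f
  refine Lp.ext ?_
  filter_upwards [translate_coeFn μ ℂ g (mulOp μ φ f),
    (measurePreserving_mul_left μ g⁻¹).quasiMeasurePreserving.ae (mulOp_coeFn μ φ f),
    mulOp_coeFn μ (translateFun g φ) (translate μ ℂ g f), translate_coeFn μ ℂ g f]
    with x h1 h2 h3 h4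
  rw [mul_apply_eq_comp, h1, h2, mul_apply_eq_comp, h3, h4, translateFun_apply]

end IsHomogeneous

theorem isHomogeneous_add {g : G} {X Y : L2 μ →L[ℂ] L2 μ} (hX : IsHomogeneous μ g X)
    (hY : IsHomogeneous μ g Y) : IsHomogeneous μ g (X + Y) := fun φ ↦ by
  rw [add_mul, mul_add, hX, hY]

theorem isHomogeneous_smul {g : G} {X : L2 μ →L[ℂ] L2 μ} (c : ℂ) (hX : IsHomogeneous μ g X) :
    IsHomogeneous μ g (c • X) := fun φ ↦ by
  rw [smul_mul_assoc, mul_smul_comm, hX]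

theorem isClosed_setOf_isHomogeneous (g : G) :
    IsClosed {X : L2 μ →L[ℂ] L2 μ | IsHomogeneous μ g X} := by
  simp only [IsHomogeneous, Set.ofPred_forall]
  exact isClosed_iInter fun φ ↦ isClosed_eq (by fun_prop) (by fun_prop)

/-- The operators on `L²(G)` that commute with multiplication by bounded continuous functions. -/
def multiplierCommutant : NonUnitalStarSubalgebra ℂ (L2 μ →L[ℂ] L2 μ) where
  carrier := {X | IsHomogeneous μ 1 X}
  add_mem' := isHomogeneous_add μ
  zero_mem' := fun φ ↦ by simp
  mul_mem' hX hY := by simpa using hX.mul hY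
  smul_mem' c _ hX := isHomogeneous_smul μ c hX
  star_mem' hX := by simpa using hX.star

end Multiplication

/-! ### Degrees of the monomials and of the range of Φ -/

section Homogeneous

variable {G : Type*} [Group G] [TopologicalSpace G] [IsTopologicalGroup G] [T2Space G]
  [MeasurableSpace G] [BorelSpace G] (μ : Measure G) [μ.InnerRegularCompactLTTop]
  [μ.IsMulLeftInvariant] (S : Submonoid G)

theorem adjoint_incl : (incl μ S).toContinuousLinearMap.adjoint = restr μ S := by
  symm
  rw [ContinuousLinearMap.eq_adjoint_iff]
  intro f g
  exact Submodule.inner_orthogonalProjectionOnto_eq_of_mem_right (K := supportedOn μ (S : Set G))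
    g f

theorem liftOp_incl_apply (A : HS μ S →L[ℂ] HS μ S) (f : L2 μ) :
    liftOp (incl μ S) A f = incl μ S (A (restr μ S f)) := by
  rw [← adjoint_incl]
  rfl

theorem liftOp_incl_one : liftOp (incl μ S) 1 = proj μ (S : Set G) := by
  ext1 f
  rw [liftOp_incl_apply]
  rfl

theorem liftOp_incl_restr_comp (X : L2 μ →L[ℂ] L2 μ) :
    liftOp (incl μ S) (restr μ S ∘L X ∘L (incl μ S).toContinuousLinearMap) =
      proj μ (S : Set G) * X * proj μ (S : Set G) := by
  ext1 f
  rw [liftOp_incl_apply]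
  rfl

theorem liftOp_T (a : S) : liftOp (incl μ S) (T μ S a) =
    proj μ (S : Set G) * leftReg μ (a : G) * proj μ (S : Set G) :=
  liftOp_incl_restr_comp μ S _

theorem isHomogeneous_liftOp_T (a : S) :
    IsHomogeneous μ (a : G) (liftOp (incl μ S) (T μ S a)) := by
  rw [liftOp_T]
  simpa using ((IsHomogeneous.of_proj (S : Set G)).mul (IsHomogeneous.leftReg (a : G))).mul
    (IsHomogeneous.of_proj (μ := μ) (S : Set G))

/-- This is where the index of a word acquires an operator meaning: each letter contributes its own
group element to the degree, and the empty word gives E_S, of degree e. -/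
theorem isHomogeneous_liftOp_monomial (w : List (S ⊕ S)) :
    IsHomogeneous μ (index w) (liftOp (incl μ S) (monomial μ S w)) := by
  induction w with
  | nil =>
    change IsHomogeneous μ 1 (liftOp (incl μ S) 1)
    rw [liftOp_incl_one]
    exact IsHomogeneous.of_proj _
  | cons l w ih =>
    have h1 : monomial μ S (l :: w) = letterOp μ S l * monomial μ S w := by simp [monomial]
    have h2 : index (l :: w) =
        Sum.elim (fun a : S ↦ (a : G)) (fun a : S ↦ (a : G)⁻¹) l * index w := by simp [index]
    rw [h1, h2, map_mul]
    refine IsHomogeneous.mul ?_ ih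
    cases l with
    | inl a => exact isHomogeneous_liftOp_T μ S a
    | inr a =>
      change IsHomogeneous μ (a : G)⁻¹ (liftOp (incl μ S) (star (T μ S a)))
      rw [map_star]
      exact (isHomogeneous_liftOp_T μ S a).star

theorem continuous_liftOp_incl : Continuous (liftOp (incl μ S)) :=
  (AddMonoidHomClass.isometry_of_norm (liftOp (incl μ S)) (norm_liftOp _)).continuous

/-- The operators of degree e form a norm-closed *-algebra, so it suffices to look at the generating
monomials, whose index is e. -/
theorem isHomogeneous_liftOp_subtype (A : DAlg μ S) :
    IsHomogeneous μ 1 (liftOp (incl μ S) (DAlg.subtype μ S A)) := by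
  have h : DDelta μ S ≤ (multiplierCommutant μ).comap (liftOp (incl μ S)) := by
    refine cstarGen_le ?_ ((isClosed_setOf_isHomogeneous μ 1).preimage
      (continuous_liftOp_incl μ S))
    rintro _ ⟨w, hw, rfl⟩
    have := isHomogeneous_liftOp_monomial μ S w
    rwa [hw] at this
  exact h A.2

variable [LeftGenerates S]

/-- On the copy at q the degree is q⁻¹ · e · q = e; the general case follows by density. -/
theorem isHomogeneous_Phi (u : DInf μ S) : IsHomogeneous μ 1 (Phi μ S u) := by
  refine DInf_induction μ S (p := fun u ↦ IsHomogeneous μ 1 (Phi μ S u)) u ?_ fun q A ↦ ?_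
  · exact (isClosed_setOf_isHomogeneous μ 1).preimage
      (AddMonoidHomClass.isometry_of_norm (Phi μ S) (norm_Phi μ S)).continuous
  · rw [Phi_toDInf, phi_apply]
    simpa using ((IsHomogeneous.leftReg (q.val : G)⁻¹).mul
      (isHomogeneous_liftOp_subtype μ S A)).mul (IsHomogeneous.leftReg (q.val : G))

theorem isHomogeneous_Phi_mul_leftReg (u : DInf μ S) (g : G) :
    IsHomogeneous μ g (Phi μ S u * leftReg μ g) := by
  simpa using (isHomogeneous_Phi μ S u).mul (IsHomogeneous.leftReg g)

end Homogeneous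

/-! ### Twisted tensor products a ⊗ f in L²(G; L²(G)) -/

section Tensor

variable {G : Type*} [Group G] [TopologicalSpace G] [IsTopologicalGroup G] [T2Space G]
  [LocallyCompactSpace G] [MeasurableSpace G] [BorelSpace G]
  (μ : Measure G) [μ.IsHaarMeasure] [μ.Regular]

/-- The class in `L²(G)` of a continuous function with compact support. -/
def ccToLp (a : C_c(G, ℂ)) : L2 μ :=
  (a.continuous.memLp_of_hasCompactSupport a.hasCompactSupport).toLp a

theorem ccToLp_coeFn (a : C_c(G, ℂ)) : ccToLp μ a =ᵐ[μ] a :=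
  MemLp.coeFn_toLp _

/-- Choose K compact inside t and U open around K, both differences t \ K and U \ K being small, and
a Urysohn function equal to 1 on K and 0 off U. Its c-multiple differs from the indicator only on (U
\ K) ∪ (t \ K), and there by at most ‖c‖. -/
theorem exists_ccToLp_edist_indicator_lt {t : Set G} (ht : MeasurableSet t) (hμt : μ t ≠ ∞)
    (c : ℂ) {ε : ℝ≥0∞} (hε : ε ≠ 0) :
    ∃ a : C_c(G, ℂ), edist (indicatorConstLp 2 ht hμt c) (ccToLp μ a) ≤ ε := by
  obtain ⟨η, hη, h⟩ := exists_eLpNorm_indicator_le (μ := μ) (p := 2) (by simp) c hε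
  have hη2 : (η / 2 : ℝ≥0∞) ≠ 0 := by simpa using hη.ne'
  obtain ⟨K, hKt, hK, hKμ⟩ := ht.exists_isCompact_sdiff_lt hμt hη2
  obtain ⟨U, hKU, hU, -, hUμ⟩ :=
    hK.measurableSet.exists_isOpen_sdiff_lt (hK.measure_lt_top (μ := μ)).ne hη2
  obtain ⟨f, hf1, hf0, hfc, hf⟩ := exists_continuous_one_zero_of_isCompact hK hU.isClosed_compl
    (Set.disjoint_compl_right_iff_subset.2 hKU)
  have ha : HasCompactSupport fun x ↦ (f x : ℂ) * c :=
    (hfc.comp_left (g := fun r : ℝ ↦ (r : ℂ) * c) (by simp))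
  refine ⟨⟨⟨fun x ↦ (f x : ℂ) * c, by fun_prop⟩, ha⟩, ?_⟩
  rw [Lp.edist_def]
  refine le_trans (eLpNorm_mono_ae ?_) (h ((U \ K) ∪ (t \ K)) ?_)
  · filter_upwards [ccToLp_coeFn μ ⟨⟨fun x ↦ (f x : ℂ) * c, by fun_prop⟩, ha⟩,
      indicatorConstLp_coeFn (p := 2) (hs := ht) (hμs := hμt) (c := c)] with x h1 h2
    rw [Pi.sub_apply, h1, h2]
    change ‖t.indicator (fun _ ↦ c) x - (f x : ℂ) * c‖ ≤ _
    by_cases hxK : x ∈ K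
    · have h3 : f x = 1 := hf1 hxK
      simp [h3, hKt hxK]
    · have h3 : ‖(f x : ℂ)‖ ≤ 1 := by
        rw [Complex.norm_real, Real.norm_eq_abs, abs_of_nonneg (hf x).1]
        exact (hf x).2
      have h4 : ‖1 - (f x : ℂ)‖ ≤ 1 := by
        rw [← Complex.ofReal_one, ← Complex.ofReal_sub, Complex.norm_real, Real.norm_eq_abs,
          abs_of_nonneg (by linarith [(hf x).2])]
        linarith [(hf x).1]
      by_cases hxt : x ∈ t
      · have h5 : c - (f x : ℂ) * c = (1 - (f x : ℂ)) * c := by ring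
        rw [Set.indicator_of_mem hxt, Set.indicator_of_mem (Set.mem_union_right _ (Set.mem_sdiff_of_mem hxt hxK)), h5, norm_mul]
        exact mul_le_of_le_one_left (norm_nonneg _) h4
      · by_cases hxU : x ∈ U
        · rw [Set.indicator_of_notMem hxt, Set.indicator_of_mem (Set.mem_union_left _ (Set.mem_sdiff_of_mem hxU hxK)), zero_sub,
            norm_neg, norm_mul]
          exact mul_le_of_le_one_left (norm_nonneg _) h3
        · have h5 : f x = 0 := hf0 hxU
          simp [hxt, h5]
  · exact (measure_union_le _ _).trans
      ((add_le_add hUμ.le hKμ.le).trans (ENNReal.add_halves _).le)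

theorem ccToLp_add (a b : C_c(G, ℂ)) : ccToLp μ (a + b) = ccToLp μ a + ccToLp μ b := rfl

theorem denseRange_ccToLp : DenseRange (ccToLp μ) := by
  intro f
  refine Lp.induction (p := 2) (by simp)
    (motive := fun f : L2 μ ↦ f ∈ closure (Set.range (ccToLp μ))) ?_ ?_ isClosed_closure f
  · intro c t ht hμt
    rw [EMetric.mem_closure_iff]
    intro ε hε
    obtain ⟨δ, hδ, hδε⟩ := exists_between hε
    obtain ⟨a, ha⟩ := exists_ccToLp_edist_indicator_lt μ ht hμt.ne c hδ.ne'
    exact ⟨_, ⟨a, rfl⟩, ha.trans_lt hδε⟩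
  · intro f g _ _ _ hf hg
    refine map_mem_closure₂ continuous_add hf hg ?_
    rintro _ ⟨a, rfl⟩ _ ⟨b, rfl⟩
    exact ⟨a + b, ccToLp_add μ a b⟩

theorem inner_ccToLp (a b : C_c(G, ℂ)) :
    ⟪ccToLp μ a, ccToLp μ b⟫_ℂ = ∫ x, ⟪a x, b x⟫_ℂ ∂μ := by
  rw [L2.inner_def]
  refine integral_congr_ae ?_
  filter_upwards [ccToLp_coeFn μ a, ccToLp_coeFn μ b] with x h1 h2
  rw [h1, h2]

/-- The bounded continuous function `x ↦ a (s x * h)`. -/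
def twistFun (s : C(G, G)) (a : C_c(G, ℂ)) (h : G) : G →ᵇ ℂ :=
  (a : G →ᵇ ℂ).compContinuous ⟨fun x ↦ s x * h, by fun_prop⟩

theorem twistFun_apply (s : C(G, G)) (a : C_c(G, ℂ)) (h x : G) :
    twistFun s a h x = a (s x * h) := rfl

/-- Only x in the compact support of f matters, and there x ↦ a(s(x)h) varies uniformly continuously
with h: currying gives continuity into C(G, ℂ) with the compact-open topology. -/
theorem continuous_mulOp_twistFun_ccToLp (s : C(G, G)) (a f : C_c(G, ℂ)) :
    Continuous fun h ↦ mulOp μ (twistFun s a h) (ccToLp μ f) := by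
  have hF : Continuous fun p : G × G ↦ a (s p.2 * p.1) := by fun_prop
  let F : C(G, C(G, ℂ)) := ContinuousMap.curry ⟨fun p : G × G ↦ a (s p.2 * p.1), hF⟩
  refine continuous_iff_continuousAt.2 fun h₀ ↦ Metric.tendsto_nhds.2 fun ε hε ↦ ?_
  have h1 := ContinuousMap.tendsto_iff_forall_isCompact_tendstoUniformlyOn.1
    (F.continuous.tendsto h₀) (tsupport f) f.hasCompactSupport
  have hpos : 0 < ‖ccToLp μ f‖ + 1 := by positivity
  have h2 := Metric.tendstoUniformlyOn_iff.1 h1 (ε / (‖ccToLp μ f‖ + 1)) (by positivity)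
  filter_upwards [h2] with h hh
  rw [dist_eq_norm, ← mulOp_sub_apply]
  refine (norm_mulOp_apply_le μ _ _ (C := ε / (‖ccToLp μ f‖ + 1)) ?_).trans_lt ?_
  · filter_upwards [ccToLp_coeFn μ f] with x hx
    rw [hx, norm_mul]
    by_cases hxf : x ∈ tsupport f
    · refine mul_le_mul_of_nonneg_right ?_ (norm_nonneg _)
      have := (hh x hxf).le
      rw [dist_comm, dist_eq_norm] at this
      exact this
    · rw [image_eq_zero_of_notMem_tsupport hxf]
      simp
  · rw [div_mul_eq_mul_div, div_lt_iff₀ hpos]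
    exact mul_lt_mul_of_pos_left (lt_add_one _) hε

theorem isCompact_twist (s : C(G, G)) (a f : C_c(G, ℂ)) :
    IsCompact ((fun p : G × G ↦ ((s p.2)⁻¹ * p.1, p.2)) '' (tsupport a ×ˢ tsupport f)) :=
  (a.hasCompactSupport.isCompact.prod f.hasCompactSupport.isCompact).image (by fun_prop)

theorem mem_twist {s : C(G, G)} {a f : C_c(G, ℂ)} {h x : G} (h1 : a (s x * h) ≠ 0)
    (h2 : f x ≠ 0) :
    (h, x) ∈ (fun p : G × G ↦ ((s p.2)⁻¹ * p.1, p.2)) '' (tsupport a ×ˢ tsupport f) :=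
  ⟨(s x * h, x), ⟨subset_tsupport _ h1, subset_tsupport _ h2⟩, by simp⟩

theorem hasCompactSupport_mulOp_twistFun_ccToLp (s : C(G, G)) (a f : C_c(G, ℂ)) :
    HasCompactSupport fun h ↦ mulOp μ (twistFun s a h) (ccToLp μ f) := by
  refine HasCompactSupport.intro ((isCompact_twist s a f).image continuous_fst) fun h hh ↦ ?_
  refine Lp.ext ?_
  filter_upwards [mulOp_coeFn μ (twistFun s a h) (ccToLp μ f), ccToLp_coeFn μ f,
    Lp.coeFn_zero ℂ 2 μ] with x h1 h2 h3
  rw [h1, h2, h3, twistFun_apply, Pi.zero_apply]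
  by_contra hne
  exact hh ⟨_, mem_twist (left_ne_zero_of_mul hne) (right_ne_zero_of_mul hne), rfl⟩

/-- After exchanging the integrals, h ↦ s(x)h is a left translation in the inner one, so invariance
of μ removes s and the double integral factors. Compact support of the integrand justifies the
exchange without σ-finiteness. -/
theorem integral_inner_mulOp_twistFun (s : C(G, G)) (a b f g : C_c(G, ℂ)) :
    ∫ h, ⟪mulOp μ (twistFun s a h) (ccToLp μ f), mulOp μ (twistFun s b h) (ccToLp μ g)⟫_ℂ ∂μ =
      ⟪ccToLp μ a, ccToLp μ b⟫_ℂ * ⟪ccToLp μ f, ccToLp μ g⟫_ℂ := by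
  let F : G → G → ℂ := fun h x ↦ ⟪a (s x * h), b (s x * h)⟫_ℂ * ⟪f x, g x⟫_ℂ
  have hF : Continuous F.uncurry := by
    change Continuous fun p : G × G ↦ ⟪a (s p.2 * p.1), b (s p.2 * p.1)⟫_ℂ * ⟪f p.2, g p.2⟫_ℂ
    fun_prop
  have hFs : HasCompactSupport F.uncurry := by
    refine HasCompactSupport.intro (isCompact_twist s a f) fun p hp ↦ ?_
    by_contra hne
    refine hp (mem_twist (h := p.1) (x := p.2) (fun h ↦ hne ?_) (fun h ↦ hne ?_)) <;>
    simp [F, Function.uncurry, h]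
  have h1 : ∀ h, ⟪mulOp μ (twistFun s a h) (ccToLp μ f),
      mulOp μ (twistFun s b h) (ccToLp μ g)⟫_ℂ = ∫ x, F h x ∂μ := fun h ↦ by
    rw [L2.inner_def]
    refine integral_congr_ae ?_
    filter_upwards [mulOp_coeFn μ (twistFun s a h) (ccToLp μ f), ccToLp_coeFn μ f,
      mulOp_coeFn μ (twistFun s b h) (ccToLp μ g), ccToLp_coeFn μ g] with x h1 h2 h3 h4
    rw [h1, h2, h3, h4, twistFun_apply, twistFun_apply]
    simp only [F, RCLike.inner_apply, map_mul]
    ring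
  simp only [h1]
  rw [integral_integral_swap_of_hasCompactSupport hF hFs]
  simp only [F]
  simp_rw [integral_mul_const]
  have h2 : ∀ x, ∫ h, ⟪a (s x * h), b (s x * h)⟫_ℂ ∂μ = ⟪ccToLp μ a, ccToLp μ b⟫_ℂ := fun x ↦ by
    rw [inner_ccToLp]
    exact integral_mul_left_eq_self (fun h ↦ ⟪a h, b h⟫_ℂ) (s x)
  simp_rw [h2]
  rw [integral_const_mul, inner_ccToLp μ f g]

theorem memLp_mulOp_twistFun_ccToLp (s : C(G, G)) (a f : C_c(G, ℂ)) :
    MemLp (fun h ↦ mulOp μ (twistFun s a h) (ccToLp μ f)) 2 μ :=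
  (continuous_mulOp_twistFun_ccToLp μ s a f).memLp_of_hasCompactSupport
    (hasCompactSupport_mulOp_twistFun_ccToLp μ s a f)

theorem eLpNorm_mulOp_twistFun_ccToLp (s : C(G, G)) (a f : C_c(G, ℂ)) :
    eLpNorm (fun h ↦ mulOp μ (twistFun s a h) (ccToLp μ f)) 2 μ =
      ENNReal.ofReal (‖ccToLp μ a‖ * ‖ccToLp μ f‖) := by
  have hm := memLp_mulOp_twistFun_ccToLp μ s a f
  rw [← Lp.enorm_toLp hm, ← ofReal_norm]
  congr 1
  have h : ⟪hm.toLp _, hm.toLp _⟫_ℂ =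
      ⟪ccToLp μ a, ccToLp μ a⟫_ℂ * ⟪ccToLp μ f, ccToLp μ f⟫_ℂ := by
    rw [← integral_inner_mulOp_twistFun μ s, L2.inner_def]
    refine integral_congr_ae ?_
    filter_upwards [hm.coeFn_toLp] with x hx
    rw [hx]
  simp only [inner_self_eq_norm_sq_to_K] at h
  have h' : ‖hm.toLp _‖ ^ 2 = (‖ccToLp μ a‖ * ‖ccToLp μ f‖) ^ 2 := by
    rw [mul_pow]
    exact_mod_cast h
  exact (pow_left_inj₀ (norm_nonneg _) (by positivity) two_ne_zero).1 h'

theorem exists_seq_ccToLp (f : L2 μ) :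
    ∃ u : ℕ → C_c(G, ℂ), Tendsto (fun n ↦ ccToLp μ (u n)) atTop (𝓝 f) := by
  obtain ⟨v, hv, hlim⟩ := mem_closure_iff_seq_limit.1 (denseRange_ccToLp μ f)
  choose u hu using hv
  exact ⟨u, by simpa only [hu] using hlim⟩

/-- Approximating f by continuous functions with compact support gives convergence for every h,
since each multiplication operator is bounded; Fatou's lemma then carries the exact norm over as a
bound. -/
theorem eLpNorm_mulOp_twistFun_le (s : C(G, G)) (a : C_c(G, ℂ)) (f : L2 μ) :
    AEStronglyMeasurable (fun h ↦ mulOp μ (twistFun s a h) f) μ ∧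
      eLpNorm (fun h ↦ mulOp μ (twistFun s a h) f) 2 μ ≤
        ENNReal.ofReal (‖ccToLp μ a‖ * ‖f‖) := by
  obtain ⟨u, hu⟩ := exists_seq_ccToLp μ f
  have hm := fun n ↦ memLp_mulOp_twistFun_ccToLp μ s a (u n)
  have hlim : ∀ᵐ h ∂μ, Tendsto (fun n ↦ mulOp μ (twistFun s a h) (ccToLp μ (u n))) atTop
      (𝓝 (mulOp μ (twistFun s a h) f)) :=
    ae_of_all _ fun h ↦ ((mulOp μ (twistFun s a h)).continuous.tendsto _).comp hu
  refine ⟨aestronglyMeasurable_of_tendsto_ae atTop (fun n ↦ (hm n).1) hlim, ?_⟩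
  refine (Lp.eLpNorm_lim_le_liminf_eLpNorm (fun n ↦ (hm n).1) _ hlim).trans ?_
  simp only [eLpNorm_mulOp_twistFun_ccToLp]
  exact (((ENNReal.continuous_ofReal.comp (continuous_const.mul continuous_norm)).tendsto
    f).comp hu).liminf_eq.le

theorem memLp_mulOp_twistFun (s : C(G, G)) (a : C_c(G, ℂ)) (f : L2 μ) :
    MemLp (fun h ↦ mulOp μ (twistFun s a h) f) 2 μ :=
  ⟨(eLpNorm_mulOp_twistFun_le μ s a f).1,
    (eLpNorm_mulOp_twistFun_le μ s a f).2.trans_lt ENNReal.ofReal_lt_top⟩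

/-- The operator `V_s(a)` from `L²(G)` to `L²(G; L²(G))` given by
`(V_s(a) f)(h) = (x ↦ a (s x * h) f x)`. -/
def twistOp (s : C(G, G)) (a : C_c(G, ℂ)) : L2 μ →L[ℂ] L2L2 μ :=
  LinearMap.mkContinuous
    { toFun := fun f ↦ (memLp_mulOp_twistFun μ s a f).toLp _
      map_add' := fun f g ↦ by
        simp only [map_add]
        exact MemLp.toLp_add (memLp_mulOp_twistFun μ s a f) (memLp_mulOp_twistFun μ s a g)
      map_smul' := fun c f ↦ by
        simp only [map_smul]
        exact MemLp.toLp_const_smul c (memLp_mulOp_twistFun μ s a f) }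
    ‖ccToLp μ a‖ fun f ↦ by
      change ‖(memLp_mulOp_twistFun μ s a f).toLp _‖ ≤ _
      rw [Lp.norm_toLp]
      exact ENNReal.toReal_le_of_le_ofReal (by positivity) (eLpNorm_mulOp_twistFun_le μ s a f).2

theorem twistOp_coeFn (s : C(G, G)) (a : C_c(G, ℂ)) (f : L2 μ) :
    twistOp μ s a f =ᵐ[μ] fun h ↦ mulOp μ (twistFun s a h) f :=
  (memLp_mulOp_twistFun μ s a f).coeFn_toLp

/-- The twist does not change inner products of elementary tensors. It is used with s(x) = x⁻¹ to
construct π and with s(x) = x to prove π injective. -/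
theorem inner_twistOp (s : C(G, G)) (a b : C_c(G, ℂ)) (f g : L2 μ) :
    ⟪twistOp μ s a f, twistOp μ s b g⟫_ℂ = ⟪ccToLp μ a, ccToLp μ b⟫_ℂ * ⟪f, g⟫_ℂ := by
  refine (denseRange_ccToLp μ).induction_on₂ (p := fun f g ↦
    ⟪twistOp μ s a f, twistOp μ s b g⟫_ℂ = ⟪ccToLp μ a, ccToLp μ b⟫_ℂ * ⟪f, g⟫_ℂ) ?_ ?_ f g
  · exact isClosed_eq (by fun_prop) (by fun_prop)
  · intro f g
    rw [← integral_inner_mulOp_twistFun μ s, L2.inner_def]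
    refine integral_congr_ae ?_
    filter_upwards [twistOp_coeFn μ s a (ccToLp μ f), twistOp_coeFn μ s b (ccToLp μ g)]
      with x h1 h2
    rw [h1, h2]

end Tensor

/-! ### Covariance and the linear span of the generators -/

section CrossedProductAlgebra

variable {G : Type*} [Group G] [TopologicalSpace G] [IsTopologicalGroup G] [T2Space G]
  [LocallyCompactSpace G] [MeasurableSpace G] [BorelSpace G]
  (μ : Measure G) [μ.IsHaarMeasure] [μ.Regular] (S : Submonoid G) [LeftGenerates S]

theorem leftReg_inv_mul_leftReg (g : G) : leftReg μ g⁻¹ * leftReg μ g = 1 := by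
  rw [← translate_mul, inv_mul_cancel, translate_one]

theorem leftReg_mul_leftReg_inv (g : G) : leftReg μ g * leftReg μ g⁻¹ = 1 := by
  rw [← translate_mul, mul_inv_cancel, translate_one]

theorem tau_mul (g : G) (u v : DInf μ S) : tau μ S g (u * v) = tau μ S g u * tau μ S g v := by
  apply Phi_injective
  simp only [Phi_tau, map_mul, star_translate]
  calc _ = leftReg μ g * Phi μ S u * 1 * Phi μ S v * leftReg μ g⁻¹ := by
        simp only [mul_one, mul_assoc]
    _ = _ := by rw [← leftReg_inv_mul_leftReg μ g]; simp only [mul_assoc]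

theorem tau_star (g : G) (u : DInf μ S) : tau μ S g (star u) = star (tau μ S g u) := by
  apply Phi_injective
  simp only [Phi_tau, map_star, star_mul, star_star, mul_assoc]

theorem tau_tau (g h : G) (u : DInf μ S) : tau μ S g (tau μ S h u) = tau μ S (g * h) u := by
  apply Phi_injective
  simp only [Phi_tau, translate_mul, leftReg, star_mul, mul_assoc]

theorem indPhi_mul (u v : DInf μ S) : indPhi μ S (u * v) = indPhi μ S u * indPhi μ S v := by
  ext1 ξ
  refine Lp.ext ?_
  filter_upwards [indPhi_coeFn μ S (u * v) ξ, indPhi_coeFn μ S u (indPhi μ S v ξ),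
    indPhi_coeFn μ S v ξ] with h h1 h2 h3
  rw [h1, mul_apply_eq_comp, h2, h3, tau_mul, map_mul, mul_apply_eq_comp]

theorem indPhi_star (u : DInf μ S) : indPhi μ S (star u) = star (indPhi μ S u) := by
  rw [ContinuousLinearMap.star_eq_adjoint, ContinuousLinearMap.eq_adjoint_iff]
  intro ξ η
  rw [L2.inner_def, L2.inner_def]
  refine integral_congr_ae ?_
  filter_upwards [indPhi_coeFn μ S (star u) ξ, indPhi_coeFn μ S u η] with h h1 h2
  rw [h1, h2, tau_star, map_star, ContinuousLinearMap.star_eq_adjoint,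
    ContinuousLinearMap.adjoint_inner_left]

/-- The covariance relation; it is what closes the set of products u · g under multiplication and
adjoints. -/
theorem indL_mul_indPhi (g : G) (u : DInf μ S) :
    indL μ g * indPhi μ S u = indPhi μ S (tau μ S g u) * indL μ g := by
  ext1 ξ
  refine Lp.ext ?_
  filter_upwards [indPhi_coeFn μ S (tau μ S g u) (indL μ g ξ),
    translate_coeFn μ (L2 μ) g ξ, translate_coeFn μ (L2 μ) g (indPhi μ S u ξ),
    (measurePreserving_mul_left μ g⁻¹).quasiMeasurePreserving.ae (indPhi_coeFn μ S u ξ)]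
    with h h1 h2 h3 h4
  rw [mul_apply_eq_comp, mul_apply_eq_comp, h1, indL, h3, h2, h4, tau_tau, mul_inv_rev, inv_inv]

/-- The products `u · g` that generate the reduced crossed product. -/
def crossedGenerators : Set (L2L2 μ →L[ℂ] L2L2 μ) :=
  {B | ∃ (u : DInf μ S) (g : G), B = indPhi μ S u * indL μ g}

theorem crossedGenerators_mul_mem {A B : L2L2 μ →L[ℂ] L2L2 μ} (hA : A ∈ crossedGenerators μ S)
    (hB : B ∈ crossedGenerators μ S) : A * B ∈ crossedGenerators μ S := by
  obtain ⟨u, g, rfl⟩ := hA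
  obtain ⟨v, h, rfl⟩ := hB
  refine ⟨u * tau μ S g v, g * h, ?_⟩
  rw [indPhi_mul, mul_assoc, ← mul_assoc (indL μ g), indL_mul_indPhi, indL, indL, indL,
    translate_mul]
  simp only [mul_assoc]

theorem crossedGenerators_star_mem {A : L2L2 μ →L[ℂ] L2L2 μ} (hA : A ∈ crossedGenerators μ S) :
    star A ∈ crossedGenerators μ S := by
  obtain ⟨u, g, rfl⟩ := hA
  refine ⟨tau μ S g⁻¹ (star u), g⁻¹, ?_⟩
  rw [← indL_mul_indPhi, star_mul, ← indPhi_star, indL, indL, star_translate]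

/-- By covariance the *-algebra generated by the products u · g is just their linear span. Hence no
product or star case is needed, which matters because compression is a priori only linear. -/
theorem crossedProduct_induction {p : (L2L2 μ →L[ℂ] L2L2 μ) → Prop} (hp : IsClosed {A | p A})
    (hgen : ∀ u g, p (indPhi μ S u * indL μ g)) (hzero : p 0)
    (hadd : ∀ A B, p A → p B → p (A + B)) (hsmul : ∀ (c : ℂ) A, p A → p (c • A))
    {A : L2L2 μ →L[ℂ] L2L2 μ} (hA : A ∈ crossedProduct μ S) : p A := by
  have h1 : (NonUnitalStarAlgebra.adjoin ℂ (crossedGenerators μ S) : Set _) ⊆ {A | p A} := by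
    intro B hB
    have hB' : B ∈ (NonUnitalStarAlgebra.adjoin ℂ (crossedGenerators μ S)).toSubmodule := hB
    rw [NonUnitalStarAlgebra.adjoin_eq_span] at hB'
    clear hB
    induction hB' using Submodule.span_induction with
    | mem x hx =>
      have hx' : x ∈ crossedGenerators μ S := by
        induction hx using Subsemigroup.closure_induction with
        | mem y hy =>
          rcases hy with hy | hy
          · exact hy
          · simpa using crossedGenerators_star_mem μ S hy
        | mul y z _ _ h1 h2 => exact crossedGenerators_mul_mem μ S h1 h2
      obtain ⟨u, g, rfl⟩ := hx'
      exact hgen u g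
    | zero => exact hzero
    | add x y _ _ h1 h2 => exact hadd x y h1 h2
    | smul c x _ h => exact hsmul c x h
  exact closure_minimal h1 hp hA

end CrossedProductAlgebra

/-! ### The representation π as a compression to an invariant subspace -/

section Slice

variable {G : Type*} [Group G] [TopologicalSpace G] [IsTopologicalGroup G] [T2Space G]
  [LocallyCompactSpace G] [MeasurableSpace G] [BorelSpace G]
  (μ : Measure G) [μ.IsHaarMeasure] [μ.Regular] (S : Submonoid G) [LeftGenerates S]

theorem norm_leftReg_le (g : G) : ‖leftReg μ g‖ ≤ 1 :=
  ContinuousLinearMap.opNorm_le_bound _ zero_le_one fun f ↦ by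
    rw [norm_translate_apply, one_mul]

/-- The unitary operator `ξ ↦ (h ↦ L_h* ξ(h))` on `L²(G; L²(G))`. -/
def untwist : L2L2 μ →L[ℂ] L2L2 μ :=
  fieldOp μ (fun h ↦ leftReg μ h⁻¹)
    (fun _ ↦ continuous_leftReg_comp μ continuous_inv continuous_const) 1
    fun _ ↦ norm_leftReg_le μ _

theorem untwist_coeFn (ξ : L2L2 μ) : untwist μ ξ =ᵐ[μ] fun h ↦ leftReg μ h⁻¹ (ξ h) :=
  fieldOp_coeFn μ _ _ _ _ ξ

theorem inner_untwist (ξ η : L2L2 μ) : ⟪untwist μ ξ, untwist μ η⟫_ℂ = ⟪ξ, η⟫_ℂ := by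
  rw [L2.inner_def, L2.inner_def]
  refine integral_congr_ae ?_
  filter_upwards [untwist_coeFn μ ξ, untwist_coeFn μ η] with h h1 h2
  rw [h1, h2, ← ContinuousLinearMap.adjoint_inner_left, ← ContinuousLinearMap.star_eq_adjoint,
    star_translate, inv_inv, ← mul_apply_eq_comp, leftReg_mul_leftReg_inv,
    one_apply_eq_self]

theorem untwist_surjective : Function.Surjective (untwist μ) := by
  intro ξ
  let W : L2L2 μ →L[ℂ] L2L2 μ := fieldOp μ (fun h ↦ leftReg μ h)
    (fun _ ↦ continuous_leftReg_comp μ continuous_id continuous_const) 1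
    fun _ ↦ norm_leftReg_le μ _
  refine ⟨W ξ, Lp.ext ?_⟩
  filter_upwards [untwist_coeFn μ (W ξ), fieldOp_coeFn μ (fun h ↦ leftReg μ h)
    (fun _ ↦ continuous_leftReg_comp μ continuous_id continuous_const) 1
    (fun _ ↦ norm_leftReg_le μ _) ξ] with h h1 h2
  rw [h1, h2, ← mul_apply_eq_comp, leftReg_inv_mul_leftReg, one_apply_eq_self]

/-- In the twisted picture the element `u · g` acts as `λ_g ⊗ Φ(u) L_g`. -/
theorem generator_untwist_coeFn (u : DInf μ S) (g : G) (ξ : L2L2 μ) :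
    (indPhi μ S u * indL μ g) (untwist μ ξ) =ᵐ[μ]
      fun h ↦ leftReg μ h⁻¹ ((Phi μ S u * leftReg μ g) (ξ (g⁻¹ * h))) := by
  filter_upwards [indPhi_coeFn μ S u (indL μ g (untwist μ ξ)),
    translate_coeFn μ (L2 μ) g (untwist μ ξ),
    (measurePreserving_mul_left μ g⁻¹).quasiMeasurePreserving.ae (untwist_coeFn μ ξ)]
    with h h1 h2 h3
  -- Since Φ(τ(h⁻¹)u) = L_h* Φ(u) L_h and the untwisting at g⁻¹h contributes L_{h⁻¹g} = L_h* L_g,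
  -- the middle factors L_h L_h* cancel.
  rw [mul_apply_eq_comp, h1, indL, h2, h3, Phi_tau, star_translate, inv_inv, mul_inv_rev, inv_inv]
  simp only [← mul_apply_eq_comp]
  congr 1
  rw [leftReg, leftReg, leftReg, translate_mul]
  calc _ = translate μ ℂ h⁻¹ * Phi μ S u * (leftReg μ h * leftReg μ h⁻¹) * leftReg μ g := by
        simp only [mul_assoc]
    _ = _ := by rw [leftReg_mul_leftReg_inv, mul_one, mul_assoc]

/-- Slicing by `a`: the operator from `L²(G)` to `L²(G; L²(G))` given by
`(slice a f)(h) = (x ↦ a (x⁻¹) f (h x))`. -/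
def slice (a : C_c(G, ℂ)) : L2 μ →L[ℂ] L2L2 μ :=
  untwist μ ∘L twistOp μ ⟨fun x ↦ x⁻¹, continuous_inv⟩ a

theorem inner_slice (a b : C_c(G, ℂ)) (f g : L2 μ) :
    ⟪slice μ a f, slice μ b g⟫_ℂ = ⟪ccToLp μ a, ccToLp μ b⟫_ℂ * ⟪f, g⟫_ℂ := by
  rw [← inner_twistOp μ ⟨fun x ↦ x⁻¹, continuous_inv⟩]
  exact inner_untwist μ _ _

/-- X = Φ(u)L_g has degree g, so moving it past multiplication by x ↦ a(x⁻¹g⁻¹h) replaces x by g⁻¹x;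
this undoes the shift of h produced by λ_g. -/
theorem generator_slice (a : C_c(G, ℂ)) (u : DInf μ S) (g : G) :
    (indPhi μ S u * indL μ g) ∘L slice μ a = slice μ a ∘L (Phi μ S u * leftReg μ g) := by
  ext1 f
  refine Lp.ext ?_
  let s : C(G, G) := ⟨fun x ↦ x⁻¹, continuous_inv⟩
  filter_upwards [generator_untwist_coeFn μ S u g (twistOp μ s a f),
    (measurePreserving_mul_left μ g⁻¹).quasiMeasurePreserving.ae (twistOp_coeFn μ s a f),
    untwist_coeFn μ (twistOp μ s a ((Phi μ S u * leftReg μ g) f)),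
    twistOp_coeFn μ s a ((Phi μ S u * leftReg μ g) f)] with h h1 h2 h3 h4
  rw [ContinuousLinearMap.comp_apply, ContinuousLinearMap.comp_apply, slice,
    ContinuousLinearMap.comp_apply, ContinuousLinearMap.comp_apply, h1, h2, h3, h4,
    (isHomogeneous_Phi_mul_leftReg μ S u g).apply]
  congr 2
  congr 1
  -- The cancellation is (g⁻¹x)⁻¹(g⁻¹h) = x⁻¹h.
  ext x
  simp [translateFun_apply, twistFun_apply, s]

theorem exists_norm_ccToLp_eq_one : ∃ a : C_c(G, ℂ), ‖ccToLp μ a‖ = 1 := by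
  obtain ⟨f, hfc, hf, h1⟩ := exists_continuous_nonneg_pos (1 : G)
  let a : C_c(G, ℂ) := ⟨⟨fun x ↦ (f x : ℂ), by fun_prop⟩,
    hfc.comp_left (g := fun r : ℝ ↦ (r : ℂ)) (by simp)⟩
  have ha : ‖ccToLp μ a‖ ≠ 0 := fun h ↦ by
    have h0 : (a : G → ℂ) =ᵐ[μ] fun _ ↦ 0 := by
      filter_upwards [ccToLp_coeFn μ a, Lp.coeFn_zero ℂ 2 μ] with x h2 h3
      rw [← h2, norm_eq_zero.1 h, h3, Pi.zero_apply]
    have h4 := (Continuous.ae_eq_iff_eq μ a.continuous continuous_const).1 h0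
    exact h1 (by simpa [a] using congrFun h4 1)
  refine ⟨(‖ccToLp μ a‖⁻¹ : ℂ) • a, ?_⟩
  have : ccToLp μ ((‖ccToLp μ a‖⁻¹ : ℂ) • a) = (‖ccToLp μ a‖⁻¹ : ℂ) • ccToLp μ a := rfl
  rw [this, norm_smul, norm_inv, Complex.norm_real, norm_norm, inv_mul_cancel₀ ha]

/-- A continuous function with compact support and of norm one in `L²(G)`. -/
def unitVec : C_c(G, ℂ) := (exists_norm_ccToLp_eq_one μ).choose

theorem norm_unitVec : ‖ccToLp μ (unitVec μ)‖ = 1 := (exists_norm_ccToLp_eq_one μ).choose_spec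

/-- The isometric embedding of `L²(G)` in `L²(G; L²(G))` given by slicing by a unit vector. -/
abbrev emb : L2 μ →L[ℂ] L2L2 μ := slice μ (unitVec μ)

theorem adjoint_emb_comp_emb : (emb μ).adjoint ∘L emb μ = 1 := by
  ext1 f
  refine ext_inner_left ℂ fun g ↦ ?_
  rw [ContinuousLinearMap.comp_apply, ContinuousLinearMap.adjoint_inner_right, inner_slice,
    inner_self_eq_norm_sq_to_K, norm_unitVec]
  simp

/-- The compression of an operator on `L²(G; L²(G))` to `L²(G)`. -/
def compress : (L2L2 μ →L[ℂ] L2L2 μ) →ₗ[ℂ] (L2 μ →L[ℂ] L2 μ) where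
  toFun A := (emb μ).adjoint ∘L A ∘L emb μ
  map_add' A B := by simp
  map_smul' c A := by simp

theorem continuous_compress : Continuous (compress μ) := by
  change Continuous fun A ↦ (emb μ).adjoint ∘L A ∘L emb μ
  fun_prop

theorem compress_generator (u : DInf μ S) (g : G) :
    compress μ (indPhi μ S u * indL μ g) = Phi μ S u * leftReg μ g := by
  change (emb μ).adjoint ∘L (indPhi μ S u * indL μ g) ∘L emb μ = _
  rw [generator_slice, ← ContinuousLinearMap.comp_assoc, adjoint_emb_comp_emb]
  exact one_mul _

/-- The range of `emb` is invariant under the crossed product, so compression to it is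
multiplicative there. -/
theorem comp_emb {A : L2L2 μ →L[ℂ] L2L2 μ} (hA : A ∈ crossedProduct μ S) :
    A ∘L emb μ = emb μ ∘L compress μ A := by
  refine crossedProduct_induction μ S (p := fun A ↦ A ∘L emb μ = emb μ ∘L compress μ A)
    ?_ ?_ ?_ ?_ ?_ hA
  · have := continuous_compress μ
    exact isClosed_eq (by fun_prop) (by fun_prop)
  · intro u g
    rw [compress_generator, generator_slice]
  · simp
  · intro A B hA hB
    rw [map_add, ContinuousLinearMap.add_comp, hA, hB, ContinuousLinearMap.comp_add]
  · intro c A hA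
    rw [map_smul, ContinuousLinearMap.smul_comp, hA, ContinuousLinearMap.comp_smul]

/-- The representation `π` of the reduced crossed product on `L²(G)`. -/
def crossedRep : crossedProduct μ S →⋆ₙₐ[ℂ] (L2 μ →L[ℂ] L2 μ) where
  toFun A := compress μ A
  map_smul' c A := map_smul (compress μ) c (A : L2L2 μ →L[ℂ] L2L2 μ)
  map_zero' := map_zero (compress μ)
  map_add' A B := map_add (compress μ) (A : L2L2 μ →L[ℂ] L2L2 μ) B
  map_mul' A B := by
    change (emb μ).adjoint ∘L ((A : L2L2 μ →L[ℂ] L2L2 μ) ∘L (B : L2L2 μ →L[ℂ] L2L2 μ)) ∘L emb μ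
      = ((emb μ).adjoint ∘L (A : L2L2 μ →L[ℂ] L2L2 μ) ∘L emb μ) ∘L compress μ B
    simp only [ContinuousLinearMap.comp_assoc]
    rw [comp_emb μ S B.2]
  map_star' A := by
    change (emb μ).adjoint ∘L (A : L2L2 μ →L[ℂ] L2L2 μ).adjoint ∘L emb μ =
      ((emb μ).adjoint ∘L (A : L2L2 μ →L[ℂ] L2L2 μ) ∘L emb μ).adjoint
    simp only [ContinuousLinearMap.adjoint_comp, ContinuousLinearMap.adjoint_adjoint,
      ContinuousLinearMap.comp_assoc]

theorem crossedRep_mk (u : DInf μ S) (g : G) :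
    crossedRep μ S (crossedProduct.mk μ S u g) = Phi μ S u * leftReg μ g :=
  compress_generator μ S u g

end Slice

/-! ### Fell absorption and faithfulness of π -/

section Injectivity

variable {G : Type*} [Group G] [TopologicalSpace G] [IsTopologicalGroup G] [T2Space G]
  [LocallyCompactSpace G] [MeasurableSpace G] [BorelSpace G]
  (μ : Measure G) [μ.IsHaarMeasure] [μ.Regular] (S : Submonoid G) [LeftGenerates S]

/-- The map `f ↦ f ⊗ v` from `L²(G)` to `L²(G; L²(G))`. -/
def tensorRight (v : L2 μ) : L2 μ →L[ℂ] L2L2 μ :=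
  (ContinuousLinearMap.toSpanSingleton ℂ v).compLpL 2 μ

theorem tensorRight_coeFn (v f : L2 μ) : tensorRight μ v f =ᵐ[μ] fun h ↦ f h • v :=
  ContinuousLinearMap.coeFn_compLpL _ _

theorem inner_tensorRight (v w f g : L2 μ) :
    ⟪tensorRight μ v f, tensorRight μ w g⟫_ℂ = ⟪f, g⟫_ℂ * ⟪v, w⟫_ℂ := by
  rw [L2.inner_def, L2.inner_def f g, ← integral_mul_const]
  refine integral_congr_ae ?_
  filter_upwards [tensorRight_coeFn μ v f, tensorRight_coeFn μ w g] with h h1 h2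
  rw [h1, h2, inner_smul_left, inner_smul_right, RCLike.inner_apply]
  ring

/-- Elementary tensors are total: density of C_c(G) allows indicator functions as first factor, and
these tensors give the simple functions. -/
theorem eq_zero_of_forall_tensorRight {X : L2L2 μ →L[ℂ] L2L2 μ}
    (hX : ∀ v a, X (tensorRight μ v (ccToLp μ a)) = 0) : X = 0 := by
  have h1 : ∀ v f, X (tensorRight μ v f) = 0 := fun v f ↦
    (denseRange_ccToLp μ).induction_on (p := fun f ↦ X (tensorRight μ v f) = 0) f
      (isClosed_eq (by fun_prop) (by fun_prop)) (hX v)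
  ext1 ξ
  refine Lp.induction (p := 2) (by simp) (motive := fun ξ : L2L2 μ ↦ X ξ = 0) ?_ ?_
    (isClosed_eq (by fun_prop) (by fun_prop)) ξ
  · intro c t ht hμt
    rw [← h1 c (indicatorConstLp 2 ht hμt.ne 1)]
    congr 1
    refine Lp.ext ?_
    rw [Lp.simpleFunc.coe_indicatorConst]
    filter_upwards [tensorRight_coeFn μ c (indicatorConstLp 2 ht hμt.ne 1),
      indicatorConstLp_coeFn (p := 2) (hs := ht) (hμs := hμt.ne) (c := (1 : ℂ)),
      indicatorConstLp_coeFn (p := 2) (hs := ht) (hμs := hμt.ne) (c := c)] with x h2 h3 h4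
    rw [h2, h3, h4]
    by_cases hx : x ∈ t <;> simp [hx]
  · intro f g _ _ _ hf hg
    rw [map_add, hf, hg, add_zero]

/-- The amplification `1 ⊗ B` of an operator `B` on `L²(G)` to `L²(G; L²(G))`. -/
def amplify : (L2 μ →L[ℂ] L2 μ) →L[ℂ] L2L2 μ →L[ℂ] L2L2 μ :=
  ContinuousLinearMap.compLpL₂ 2 μ (ContinuousLinearMap.id ℂ (L2 μ →L[ℂ] L2 μ))

theorem amplify_coeFn (B : L2 μ →L[ℂ] L2 μ) (ξ : L2L2 μ) :
    amplify μ B ξ =ᵐ[μ] fun h ↦ B (ξ h) :=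
  ContinuousLinearMap.coeFn_compLp B ξ

/-- The pairs `(W* (a ⊗ v), V (a ⊗ v))`, where `W` is the twist `(Wξ)(h) = L_h ξ(h)` and `V` is
given by `(V (a ⊗ v))(h) = (x ↦ a (x h) v x)`. -/
def fellPairs : Set (L2L2 μ × L2L2 μ) :=
  {p | ∃ (a : C_c(G, ℂ)) (v : L2 μ),
    p = (untwist μ (tensorRight μ v (ccToLp μ a)), twistOp μ (ContinuousMap.id G) a v)}

/-- The graph of the isometry of Fell's absorption principle. -/
def fellGraph : Submodule ℂ (L2L2 μ × L2L2 μ) :=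
  (Submodule.span ℂ (fellPairs μ)).topologicalClosure

theorem mem_fellGraph (a : C_c(G, ℂ)) (v : L2 μ) :
    (untwist μ (tensorRight μ v (ccToLp μ a)), twistOp μ (ContinuousMap.id G) a v) ∈
      fellGraph μ :=
  Submodule.le_topologicalClosure _ (Submodule.subset_span ⟨a, v, rfl⟩)

/-- Both coordinates of the spanning pairs have Gram matrix ⟨a, b⟩⟨v, w⟩. Arguing with the graph
avoids checking that a map given on elementary tensors is well defined. -/
theorem inner_fst_eq_inner_snd {p q : L2L2 μ × L2L2 μ} (hp : p ∈ Submodule.span ℂ (fellPairs μ))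
    (hq : q ∈ Submodule.span ℂ (fellPairs μ)) : ⟪p.1, q.1⟫_ℂ = ⟪p.2, q.2⟫_ℂ := by
  induction hp, hq using Submodule.span_induction₂ with
  | mem_mem x y hx hy =>
    obtain ⟨a, v, rfl⟩ := hx
    obtain ⟨b, w, rfl⟩ := hy
    rw [inner_untwist, inner_tensorRight, inner_twistOp]
  | zero_left y _ => simp
  | zero_right x _ => simp
  | add_left x y z _ _ _ h1 h2 =>
    rw [Prod.fst_add, Prod.snd_add, inner_add_left, inner_add_left, h1, h2]
  | add_right x y z _ _ _ h1 h2 =>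
    rw [Prod.fst_add, Prod.snd_add, inner_add_right, inner_add_right, h1, h2]
  | smul_left r x y _ _ h =>
    rw [Prod.smul_fst, Prod.smul_snd, inner_smul_left, inner_smul_left, h]
  | smul_right r x y _ _ h =>
    rw [Prod.smul_fst, Prod.smul_snd, inner_smul_right, inner_smul_right, h]

theorem norm_fst_eq_norm_snd {p : L2L2 μ × L2L2 μ} (hp : p ∈ fellGraph μ) : ‖p.1‖ = ‖p.2‖ := by
  refine closure_minimal (t := {p : L2L2 μ × L2L2 μ | ‖p.1‖ = ‖p.2‖}) (fun q hq ↦ ?_)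
    (isClosed_eq (by fun_prop) (by fun_prop)) hp
  have h := inner_fst_eq_inner_snd μ hq hq
  rw [inner_self_eq_norm_sq_to_K, inner_self_eq_norm_sq_to_K] at h
  exact (pow_left_inj₀ (norm_nonneg _) (norm_nonneg _) two_ne_zero).1 (by exact_mod_cast h)

/-- The left translate of a continuous function with compact support. -/
def translateCc (g : G) (a : C_c(G, ℂ)) : C_c(G, ℂ) :=
  ⟨⟨fun x ↦ a (g⁻¹ * x), by fun_prop⟩,
    a.hasCompactSupport.comp_homeomorph (Homeomorph.mulLeft g⁻¹)⟩

theorem translateCc_apply (g : G) (a : C_c(G, ℂ)) (x : G) :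
    translateCc g a x = a (g⁻¹ * x) := rfl

theorem generator_untwist_tensorRight (u : DInf μ S) (g : G) (a : C_c(G, ℂ)) (v : L2 μ) :
    (indPhi μ S u * indL μ g) (untwist μ (tensorRight μ v (ccToLp μ a))) =
      untwist μ (tensorRight μ ((Phi μ S u * leftReg μ g) v) (ccToLp μ (translateCc g a))) := by
  refine Lp.ext ?_
  filter_upwards [generator_untwist_coeFn μ S u g (tensorRight μ v (ccToLp μ a)),
    (measurePreserving_mul_left μ g⁻¹).quasiMeasurePreserving.ae
      (tensorRight_coeFn μ v (ccToLp μ a)),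
    (measurePreserving_mul_left μ g⁻¹).quasiMeasurePreserving.ae (ccToLp_coeFn μ a),
    untwist_coeFn μ (tensorRight μ ((Phi μ S u * leftReg μ g) v) (ccToLp μ (translateCc g a))),
    tensorRight_coeFn μ ((Phi μ S u * leftReg μ g) v) (ccToLp μ (translateCc g a)),
    ccToLp_coeFn μ (translateCc g a)] with h h1 h2 h3 h4 h5 h6
  rw [h1, h2, h3, h4, h5, h6, translateCc_apply, map_smul]

theorem amplify_twistOp (u : DInf μ S) (g : G) (a : C_c(G, ℂ)) (v : L2 μ) :
    amplify μ (Phi μ S u * leftReg μ g) (twistOp μ (ContinuousMap.id G) a v) =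
      twistOp μ (ContinuousMap.id G) (translateCc g a) ((Phi μ S u * leftReg μ g) v) := by
  refine Lp.ext ?_
  filter_upwards [amplify_coeFn μ (Phi μ S u * leftReg μ g)
      (twistOp μ (ContinuousMap.id G) a v), twistOp_coeFn μ (ContinuousMap.id G) a v,
    twistOp_coeFn μ (ContinuousMap.id G) (translateCc g a) ((Phi μ S u * leftReg μ g) v)]
    with h h1 h2 h3
  rw [h1, h2, h3, (isHomogeneous_Phi_mul_leftReg μ S u g).apply]
  congr 2
  ext x
  simp [translateFun_apply, twistFun_apply, translateCc_apply, mul_assoc]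

/-- The pair of a ⊗ v goes to the pair of λ_g a ⊗ Xv, with X = Φ(u)L_g. In the first coordinate λ_g
shifts a; in the second, where only X acts, the shift comes from homogeneity. -/
theorem generator_mem_fellGraph (u : DInf μ S) (g : G) {p : L2L2 μ × L2L2 μ}
    (hp : p ∈ fellGraph μ) :
    ((indPhi μ S u * indL μ g) p.1, amplify μ (Phi μ S u * leftReg μ g) p.2) ∈ fellGraph μ := by
  let F : (L2L2 μ × L2L2 μ) →L[ℂ] L2L2 μ × L2L2 μ :=
    (indPhi μ S u * indL μ g).prodMap (amplify μ (Phi μ S u * leftReg μ g))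
  have h1 : Submodule.span ℂ (fellPairs μ) ≤ (fellGraph μ).comap F.toLinearMap := by
    refine Submodule.span_le.2 ?_
    rintro _ ⟨a, v, rfl⟩
    have := mem_fellGraph μ (translateCc g a) ((Phi μ S u * leftReg μ g) v)
    rw [← generator_untwist_tensorRight, ← amplify_twistOp] at this
    exact this
  exact Submodule.topologicalClosure_minimal _ h1
    ((Submodule.isClosed_topologicalClosure _).preimage F.continuous) hp

theorem crossedProduct_mem_fellGraph {A : L2L2 μ →L[ℂ] L2L2 μ} (hA : A ∈ crossedProduct μ S)
    {p : L2L2 μ × L2L2 μ} (hp : p ∈ fellGraph μ) :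
    (A p.1, amplify μ (compress μ A) p.2) ∈ fellGraph μ := by
  refine crossedProduct_induction μ S
    (p := fun A ↦ (A p.1, amplify μ (compress μ A) p.2) ∈ fellGraph μ) ?_ ?_ ?_ ?_ ?_ hA
  · have := continuous_compress μ
    exact (Submodule.isClosed_topologicalClosure _).preimage
      (f := fun A : L2L2 μ →L[ℂ] L2L2 μ ↦ (A p.1, amplify μ (compress μ A) p.2)) (by fun_prop)
  · intro u g
    rw [compress_generator]
    exact generator_mem_fellGraph μ S u g hp
  · rw [map_zero, map_zero]
    exact (fellGraph μ).zero_mem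
  · intro A B hA hB
    simpa using (fellGraph μ).add_mem hA hB
  · intro c A hA
    simpa using (fellGraph μ).smul_mem c hA

theorem crossedRep_injective : Function.Injective (crossedRep μ S) := by
  refine (injective_iff_map_eq_zero _).2 fun A hA ↦ Subtype.ext ?_
  have hA' : compress μ (A : L2L2 μ →L[ℂ] L2L2 μ) = 0 := hA
  have h1 : (A : L2L2 μ →L[ℂ] L2L2 μ) ∘L untwist μ = 0 :=
    eq_zero_of_forall_tensorRight μ fun v a ↦ by
      -- The second coordinate is (1 ⊗ π(A)) applied to a vector, which is zero, so the first
      -- coordinate has norm zero.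
      have h2 := norm_fst_eq_norm_snd μ
        (crossedProduct_mem_fellGraph μ S A.2 (mem_fellGraph μ a v))
      simpa [hA'] using h2
  change (A : L2L2 μ →L[ℂ] L2L2 μ) = 0
  ext1 ξ
  obtain ⟨η, rfl⟩ := untwist_surjective μ ξ
  exact DFunLike.congr_fun h1 η

end Injectivity

/-! ### C*_δ(S) as the corner of the crossed product -/

section Corner

variable {G : Type*} [Group G] [TopologicalSpace G] [IsTopologicalGroup G] [T2Space G]
  [LocallyCompactSpace G] [MeasurableSpace G] [BorelSpace G]
  (μ : Measure G) [μ.IsHaarMeasure] [μ.Regular] (S : Submonoid G)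

theorem proj_mul_liftOp (X : HS μ S →L[ℂ] HS μ S) :
    proj μ (S : Set G) * liftOp (incl μ S) X = liftOp (incl μ S) X := by
  rw [← liftOp_incl_one, ← map_mul, one_mul]

theorem liftOp_mul_proj (X : HS μ S →L[ℂ] HS μ S) :
    liftOp (incl μ S) X * proj μ (S : Set G) = liftOp (incl μ S) X := by
  rw [← liftOp_incl_one, ← map_mul, mul_one]

/-- L_a maps H_S into itself for a in S, so the outer projection in E_S L_a E_S can be dropped. -/
theorem liftOp_T_eq (a : S) :
    liftOp (incl μ S) (T μ S a) = leftReg μ (a : G) * proj μ (S : Set G) := by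
  ext1 f
  rw [liftOp_incl_apply, incl_T]
  rfl

theorem liftOp_star_T_eq (a : S) :
    liftOp (incl μ S) (star (T μ S a)) = proj μ (S : Set G) * leftReg μ (a : G)⁻¹ := by
  rw [map_star, liftOp_T_eq, star_mul, star_proj, star_translate]

theorem T_mem_CDelta (a : S) : T μ S a ∈ CDelta μ S := subset_cstarGen _ ⟨a, rfl⟩

theorem monomial_mem_CDelta (w : List (S ⊕ S)) : monomial μ S w ∈ CDelta μ S := by
  induction w with
  | nil =>
    change 1 ∈ CDelta μ S
    -- Generation is non-unital here; the identity is available because T_e = 1.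
    rw [← T_one]
    exact T_mem_CDelta μ S 1
  | cons l w ih =>
    have h1 : monomial μ S (l :: w) = letterOp μ S l * monomial μ S w := by simp [monomial]
    rw [h1]
    refine mul_mem ?_ ih
    cases l with
    | inl a => exact T_mem_CDelta μ S a
    | inr a => exact star_mem (T_mem_CDelta μ S a)

theorem DDelta_le_CDelta : DDelta μ S ≤ CDelta μ S := by
  refine cstarGen_le ?_ (isClosed_cstarGen _)
  rintro _ ⟨w, -, rfl⟩
  exact monomial_mem_CDelta μ S w

/-- The faithful representation of `C*_δ(S)` on `L²(G)`. -/
def cornerRep : CDelta μ S →⋆ₙₐ[ℂ] (L2 μ →L[ℂ] L2 μ) :=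
  (liftOp (incl μ S)).comp (NonUnitalStarSubalgebraClass.subtype (CDelta μ S))

theorem cornerRep_apply (A : CDelta μ S) : cornerRep μ S A = liftOp (incl μ S) A := rfl

theorem norm_cornerRep (A : CDelta μ S) : ‖cornerRep μ S A‖ = ‖A‖ := norm_liftOp _ _

theorem isometry_cornerRep : Isometry (cornerRep μ S) :=
  AddMonoidHomClass.isometry_of_norm (cornerRep μ S) (norm_cornerRep μ S)

variable [LeftGenerates S]

/-- The unit of `D_δ(S)`. -/
def DAlg.unit : DAlg μ S :=
  (⟨1, subset_cstarGen _ ⟨[], rfl, rfl⟩⟩ : DDelta μ S)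

theorem DAlg.subtype_unit : DAlg.subtype μ S (DAlg.unit μ S) = 1 := rfl

/-- The identity of `S` as an index. -/
def Index.one : Index S := (1 : S)

theorem Index.coe_val_one : ((Index.one S).val : G) = 1 := rfl

/-- The unit of the copy of `D_δ(S)` at the identity, as an element of `D_δ^(∞)(S)`. -/
def unitDInf : DInf μ S := toDInf μ S (Index.one S) (DAlg.unit μ S)

theorem Phi_unitDInf : Phi μ S (unitDInf μ S) = proj μ (S : Set G) := by
  rw [unitDInf, Phi_toDInf, phi_apply, DAlg.subtype_unit, liftOp_incl_one, Index.coe_val_one,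
    inv_one, leftReg, translate_one, one_mul, mul_one]

theorem exists_crossedRep_eq_cornerRep (A : CDelta μ S) :
    ∃ B, crossedRep μ S B = cornerRep μ S A := by
  have hcl : IsClosed (Set.range (crossedRep μ S)) :=
    (AddMonoidHomClass.isometry_of_norm (crossedRep μ S) (NonUnitalStarAlgHom.norm_map
      (A := cstarGen (crossedGenerators μ S)) (crossedRep μ S)
        (crossedRep_injective μ S))).isClosedEmbedding.isClosed_range
  have h : CDelta μ S ≤ (NonUnitalStarAlgHom.range (crossedRep μ S)).comap
      (liftOp (incl μ S)) := by
    refine cstarGen_le ?_ ?_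
    · rintro _ ⟨a, rfl⟩
      -- The factors are sent by π to E_S L_a and E_S, whose product is the lift of T_a.
      refine ⟨crossedProduct.mk μ S (unitDInf μ S) a * crossedProduct.mk μ S (unitDInf μ S) 1, ?_⟩
      change crossedRep μ S (_ * _) = liftOp (incl μ S) (T μ S a)
      rw [map_mul, crossedRep_mk, crossedRep_mk, Phi_unitDInf, liftOp_T, leftReg, leftReg,
        translate_one, mul_one]
    · have h1 : IsClosed (NonUnitalStarAlgHom.range (crossedRep μ S) : Set (L2 μ →L[ℂ] L2 μ)) := by
        rwa [NonUnitalStarAlgHom.coe_range]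
      exact h1.preimage (continuous_liftOp_incl μ S)
  exact h A.2

/-- The operator is E_S L_q* Y L_{qg} E_S, with Y the lift of A. Writing qg = s⁻¹t with s, t in S
and inserting E_S after Y, where it acts trivially, gives the lift of T_q* A T_s* T_t. -/
theorem proj_mul_phi_mul_leftReg_mul_proj (q : Index S) (A : DAlg μ S) (g : G) :
    ∃ X : CDelta μ S, cornerRep μ S X =
      proj μ (S : Set G) * (phi μ S q A * leftReg μ g) * proj μ (S : Set G) := by
  obtain ⟨s, hs, t, ht, h⟩ := LeftGenerates.exists_eq (S := S) ((q.val : G) * g)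
  refine ⟨⟨star (T μ S q.val) * DAlg.subtype μ S A * (star (T μ S ⟨s, hs⟩) * T μ S ⟨t, ht⟩),
    mul_mem (mul_mem (star_mem (T_mem_CDelta μ S _)) (DDelta_le_CDelta μ S A.2))
      (mul_mem (star_mem (T_mem_CDelta μ S _)) (T_mem_CDelta μ S _))⟩, ?_⟩
  rw [cornerRep_apply]
  simp only [map_mul (liftOp (incl μ S)), liftOp_star_T_eq, liftOp_T_eq, phi_apply]
  set E := proj μ (S : Set G)
  set Y := liftOp (incl μ S) (DAlg.subtype μ S A)
  have h1 : leftReg μ s⁻¹ * leftReg μ t = leftReg μ (q.val : G) * leftReg μ g := by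
    rw [← translate_mul, ← translate_mul, h]
  calc E * leftReg μ (q.val : G)⁻¹ * Y * (E * leftReg μ s⁻¹ * (leftReg μ t * E))
      = E * leftReg μ (q.val : G)⁻¹ * (Y * E) * (leftReg μ s⁻¹ * leftReg μ t) * E := by
        simp only [mul_assoc]
    _ = _ := by rw [liftOp_mul_proj, h1]; simp only [mul_assoc, Y]

theorem exists_cornerRep_eq_corner {A : L2L2 μ →L[ℂ] L2L2 μ} (hA : A ∈ crossedProduct μ S) :
    proj μ (S : Set G) * compress μ A * proj μ (S : Set G) ∈
      NonUnitalStarAlgHom.range (cornerRep μ S) := by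
  have hcl : IsClosed
      (NonUnitalStarAlgHom.range (cornerRep μ S) : Set (L2 μ →L[ℂ] L2 μ)) := by
    rw [NonUnitalStarAlgHom.coe_range]
    exact Isometry.isClosedEmbedding (α := cstarGen (Set.range (T μ S)))
      (isometry_cornerRep μ S) |>.isClosed_range
  refine crossedProduct_induction μ S
    (p := fun A ↦ proj μ (S : Set G) * compress μ A * proj μ (S : Set G) ∈
      NonUnitalStarAlgHom.range (cornerRep μ S)) ?_ ?_ ?_ ?_ ?_ hA
  · have := continuous_compress μ
    exact hcl.preimage (f := fun A : L2L2 μ →L[ℂ] L2L2 μ ↦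
      proj μ (S : Set G) * compress μ A * proj μ (S : Set G)) (by fun_prop)
  · intro u g
    rw [compress_generator]
    refine DInf_induction μ S (p := fun u ↦ proj μ (S : Set G) * (Phi μ S u * leftReg μ g) *
      proj μ (S : Set G) ∈ NonUnitalStarAlgHom.range (cornerRep μ S)) u ?_ fun q A ↦ ?_
    · have := (AddMonoidHomClass.isometry_of_norm (Phi μ S) (norm_Phi μ S)).continuous
      exact hcl.preimage (f := fun u : DInf μ S ↦
        proj μ (S : Set G) * (Phi μ S u * leftReg μ g) * proj μ (S : Set G)) (by fun_prop)
    · rw [Phi_toDInf]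
      exact proj_mul_phi_mul_leftReg_mul_proj μ S q A g
  · simp
  · intro A B hA hB
    rw [map_add, mul_add, add_mul]
    exact add_mem hA hB
  · intro c A hA
    rw [map_smul, mul_smul_comm, smul_mul_assoc]
    exact SMulMemClass.smul_mem c hA

theorem range_cornerRep : Set.range (cornerRep μ S) =
    {B | ∃ A : crossedProduct μ S,
      B = proj μ (S : Set G) * crossedRep μ S A * proj μ (S : Set G)} := by
  ext B
  constructor
  · rintro ⟨X, rfl⟩
    obtain ⟨A, hA⟩ := exists_crossedRep_eq_cornerRep μ S X
    refine ⟨A, ?_⟩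
    rw [hA, cornerRep_apply, proj_mul_liftOp, liftOp_mul_proj]
  · rintro ⟨A, rfl⟩
    exact exists_cornerRep_eq_corner μ S A.2

end Corner

end SemigroupCStar
end

theorem theorem4p2 {G : Type*} [Group G] [TopologicalSpace G] [IsTopologicalGroup G] [T2Space G]
    [LocallyCompactSpace G] [MeasurableSpace G] [BorelSpace G]
    (μ : Measure G) [μ.IsHaarMeasure] [μ.Regular]
    (S : Submonoid G) (hS : IsClosed (S : Set G)) [SemigroupCStar.LeftGenerates S] :
    ∃ π : SemigroupCStar.crossedProduct μ S →⋆ₙₐ[ℂ]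
        (SemigroupCStar.L2 μ →L[ℂ] SemigroupCStar.L2 μ),
      Function.Injective π ∧
      (∀ (u : SemigroupCStar.DInf μ S) (g : G),
        π (SemigroupCStar.crossedProduct.mk μ S u g) =
          SemigroupCStar.Phi μ S u * SemigroupCStar.leftReg μ g) ∧
      ∃ Ψ : SemigroupCStar.CDelta μ S →⋆ₙₐ[ℂ]
          (SemigroupCStar.L2 μ →L[ℂ] SemigroupCStar.L2 μ),
        Function.Injective Ψ ∧
        Set.range Ψ = {B | ∃ A : SemigroupCStar.crossedProduct μ S,
          B = SemigroupCStar.proj μ (S : Set G) * π A * SemigroupCStar.proj μ (S : Set G)} := by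
  refine ⟨SemigroupCStar.crossedRep μ S, SemigroupCStar.crossedRep_injective μ S,
    SemigroupCStar.crossedRep_mk μ S, SemigroupCStar.cornerRep μ S, ?_,
    SemigroupCStar.range_cornerRep μ S⟩
  intro A B h
  exact Subtype.ext ((AddMonoidHomClass.isometry_of_norm (SemigroupCStar.liftOp
    (SemigroupCStar.incl μ S)) (SemigroupCStar.norm_liftOp _)).injective h)
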